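/- Let $\mathbb K\in\{\mathbb R,\mathbb C\}$; all Banach spaces are over $\mathbb K$. For a separable Banach space $X$, let $\mathcal{SB}(X)$ be the set of infinite-dimensional closed linear subspaces of $X$, with the relative Effros Borel structure, i.e. the $\sigma$-algebra generated by the sets $\{Y\in\mathcal{SB}(X): Y\cap U\neq\emptyset\}$, $U\subseteq X$ open. A separable Banach space $X$ is called ergodic if there is a Borel map $\phi:2^{\mathbb N}\to\mathcal{SB}(X)$ such that, for all $x,y\in 2^{\mathbb N}$, one has $x(n)=y(n)$ for all sufficiently large $n$ if and only if $\phi(x)$ and $\phi(y)$ are linearly homeomorphic. A Banach space $Z$ is crudely finitely representable in a Banach space $X$ if there is a constant $K>0$ such that for every finite-dimensional subspace $F$ of $Z$ there is a linear isomorphism $T$ from $F$ onto a subspace $T(F)$ of $X$ with $\|T\|\,\|T^{-1}\|\le K$. If $X$ is a separable Banach space in which $\ell_p$ is crudely finitely representable for some $2<p\le\infty$, then $X$ is ergodic. In particular, $\ell_p$ is ergodic for $2<p<\infty$. -/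

import Mathlib

open scoped ENNReal

/-- The Effros Borel structure on the closed subsets of `X`: the `σ`-algebra generated by the sets
`{F | F ∩ U ≠ ∅}`, with `U ⊆ X` open. -/
@[reducible]
def effrosBorel (X : Type*) [TopologicalSpace X] :
    MeasurableSpace (TopologicalSpace.Closeds X) :=
  MeasurableSpace.generateFrom
    {A | ∃ U : Set X, IsOpen U ∧
      A = {F : TopologicalSpace.Closeds X | ((F : Set X) ∩ U).Nonempty}}

/-- `SB 𝕜 X` is the set of infinite-dimensional closed linear subspaces of `X`. -/
def SB (𝕜 X : Type*) [RCLike 𝕜] [NormedAddCommGroup X] [NormedSpace 𝕜 X] : Type _ :=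
  {Y : ClosedSubmodule 𝕜 X // ¬ FiniteDimensional 𝕜 Y.toSubmodule}

/-- `SB 𝕜 X` carries the relative Effros Borel structure. -/
instance SB.instMeasurableSpace (𝕜 X : Type*) [RCLike 𝕜] [NormedAddCommGroup X]
    [NormedSpace 𝕜 X] : MeasurableSpace (SB 𝕜 X) :=
  MeasurableSpace.comap (fun Y : SB 𝕜 X => Y.1.toCloseds) (effrosBorel X)

/-- Linear homeomorphism between infinite-dimensional closed subspaces of `X`. -/
def SB.Isomorphic {𝕜 X : Type*} [RCLike 𝕜] [NormedAddCommGroup X] [NormedSpace 𝕜 X]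
    (Y Z : SB 𝕜 X) : Prop :=
  Nonempty (Y.1.toSubmodule ≃L[𝕜] Z.1.toSubmodule)

/-- The relation of eventual agreement on the Cantor space. -/
def EventualAgreement (x y : ℕ → Bool) : Prop :=
  ∃ N : ℕ, ∀ n, N ≤ n → x n = y n

/-- Borel reducibility of the relation `R` on `α` to the relation `S` on `β`. -/
def BorelReducible {α β : Type*} [MeasurableSpace α] [MeasurableSpace β]
    (R : α → α → Prop) (S : β → β → Prop) : Prop :=
  ∃ φ : α → β, Measurable φ ∧ ∀ x y, R x y ↔ S (φ x) (φ y)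

/-- A Banach space is ergodic if it is separable and eventual agreement on the Cantor space is
Borel reducible to isomorphism between its infinite-dimensional closed subspaces. -/
def IsErgodicSpace (𝕜 X : Type*) [RCLike 𝕜] [NormedAddCommGroup X] [NormedSpace 𝕜 X]
    [CompleteSpace X] : Prop :=
  TopologicalSpace.SeparableSpace X ∧
    BorelReducible EventualAgreement (SB.Isomorphic (𝕜 := 𝕜) (X := X))

/-- `X` is `K`-crudely finitely representable in `Y`. -/
def CrudelyFinitelyRepresentableWith (𝕜 X Y : Type*) [RCLike 𝕜]
    [NormedAddCommGroup X] [NormedSpace 𝕜 X] [NormedAddCommGroup Y] [NormedSpace 𝕜 Y]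
    (K : ℝ) : Prop :=
  ∀ F : Submodule 𝕜 X, FiniteDimensional 𝕜 F →
    ∃ (G : Submodule 𝕜 Y) (T : F ≃L[𝕜] G),
      ‖(T : F →L[𝕜] G)‖ * ‖(T.symm : G →L[𝕜] F)‖ ≤ K

/-- `X` is crudely finitely representable in `Y`. -/
def CrudelyFinitelyRepresentable (𝕜 X Y : Type*) [RCLike 𝕜]
    [NormedAddCommGroup X] [NormedSpace 𝕜 X] [NormedAddCommGroup Y] [NormedSpace 𝕜 Y] : Prop :=
  ∃ K : ℝ, 0 < K ∧ CrudelyFinitelyRepresentableWith 𝕜 X Y K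

/-! In `X` one builds finite blocks of vectors `vec n ω`, `ω ∈ Ω n`, with `|Ω n| = 4 · 2 ^ n`,
biorthogonal to functionals of norm at most `3 * K`. Each block satisfies the upper estimate `‖∑ c ω
• vec n ω‖ ≤ |Ω n| ^ (1/p) * max |c|` (`exists_flatBlocks`). To `x : ℕ → Bool` corresponds the
closed span of generators with a head `a n i` on block `n` and a tail `b n (x n) i` on block `n +
1`. Changing finitely many digits of `x` changes finitely many generators, so eventual agreement
yields isomorphic spaces (`chainSpace_equiv_of_eventualAgreement`).

The converse rests on an averaged trace, in the spirit of spaces without the approximation property.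
On the space of `x`, the coefficient of a generator can be read from its head or from its tail
(`leftCoord_eq_rightCoord`), so the average over level `n` has two expressions. The tail expression
at level `n` and the head expression at level `n + 1` both live on block `n + 1`. They nearly agree
because the sign systems have small averaged correlations and `b n t` has nearly the same
correlations as `a (n + 1)`. At a level where `x` and `x'` differ, the near-orthogonality of `b n
false` and `b n true` makes the trace itself small. Random signs give correlations of order `n * 2 ^
(-n/2)`, while the blocks cost `2 ^ (n/p)`; the product is summable exactly because `p > 2`
(`exists_signSystem`).

Two isomorphisms with bounded constants and nearly equal values on the generators of one level,
composed after an approximation, would give a trace that is both near `1` and small. Hence each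
relation `IsoNear` is nowhere dense (`nowhereDenseRel_isoNear`). Countably many of them cover
isomorphism, since `X` is separable, and a block coding of the Cantor space avoids them all
(`exists_measurable_avoiding`). -/

/-! ### Random choices -/

/-- A family of balanced sign functions has a simultaneous choice of arguments for which all the
sums are of order `√|I| log |K|`. -/
theorem exists_choice_abs_sum_le {I S K : Type*} [Fintype I] [Fintype S] [Nonempty S] [Fintype K]
    [Nonempty I] (φ : K → I → S → ℝ) (h1 : ∀ k i s, φ k i s = 1 ∨ φ k i s = -1)
    (h0 : ∀ k i, ∑ s, φ k i s = 0) :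
    ∃ s : I → S, ∀ k, |∑ i, φ k i (s i)| ≤
      √(Fintype.card I) * (Real.log (2 * Fintype.card K) + 1 / 2) := by
  classical
  rcases isEmpty_or_nonempty K with hK | hK
  · exact ⟨fun _ => Classical.arbitrary S, fun k => (hK.false k).elim⟩
  set m : ℝ := (Fintype.card I : ℝ) with hm
  have hm0 : 0 < m := by rw [hm]; exact_mod_cast Fintype.card_pos
  -- With this parameter the exponential moment `cosh l ^ m` stays below `exp (1 / 2)`, whatever `m`
  -- is.
  set l : ℝ := (√m)⁻¹ with hl
  have hsm : 0 < √m := Real.sqrt_pos.2 hm0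
  have hl0 : 0 < l := inv_pos.2 hsm
  have hlm : l ^ 2 * m = 1 := by
    rw [hl, inv_pow, Real.sq_sqrt hm0.le]; field_simp
  have mgf : ∀ (k : K) (c : ℝ), ∑ s : I → S, Real.exp (c * ∑ i, φ k i (s i)) =
      (Fintype.card S * Real.cosh c) ^ Fintype.card I := by
    intro k c
    have e1 : ∀ s : I → S, Real.exp (c * ∑ i, φ k i (s i)) = ∏ i, Real.exp (c * φ k i (s i)) := by
      intro s; rw [Finset.mul_sum, Real.exp_sum]
    have e2 : ∀ i, ∑ s, Real.exp (c * φ k i s) = Fintype.card S * Real.cosh c := by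
      intro i
      have : ∀ s, Real.exp (c * φ k i s) = Real.cosh c + φ k i s * Real.sinh c := by
        intro s
        rcases h1 k i s with h | h <;> rw [h]
        · simp [Real.cosh_add_sinh]
        · rw [mul_neg_one, neg_one_mul, ← sub_eq_add_neg, Real.cosh_sub_sinh]
      simp_rw [this, Finset.sum_add_distrib, ← Finset.sum_mul, h0]
      simp
    simp_rw [e1]
    rw [← Fintype.prod_sum (fun i s => Real.exp (c * φ k i s))]
    simp_rw [e2]
    simp
  have hcosh : ∀ c : ℝ, c ^ 2 = l ^ 2 → (Real.cosh c) ^ Fintype.card I ≤ Real.exp (1 / 2) := by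
    intro c hc
    calc (Real.cosh c) ^ Fintype.card I ≤ (Real.exp (c ^ 2 / 2)) ^ Fintype.card I := by
          gcongr
          exact Real.cosh_le_exp_half_sq c
      _ = Real.exp (1 / 2) := by
          rw [← Real.exp_nat_mul, hc, ← hm]
          congr 1
          linear_combination hlm / 2
  -- Union bound in exponential form: the average over `s` of the sum of all moments, for both
  -- signs, is at most `2 * |K| * exp (1 / 2)`, so some `s` does at least as well for all `k` at
  -- once.
  have tot : ∑ s : I → S, ∑ k, (Real.exp (l * ∑ i, φ k i (s i)) +
      Real.exp (-l * ∑ i, φ k i (s i))) ≤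
      ∑ _s : I → S, 2 * Fintype.card K * Real.exp (1 / 2) := by
    rw [Finset.sum_comm]
    simp_rw [Finset.sum_add_distrib, mgf, mul_pow]
    have h1 := hcosh l rfl
    have h2 := hcosh (-l) (by ring)
    simp only [Finset.sum_const, Finset.card_univ, nsmul_eq_mul, Fintype.card_fun, Nat.cast_pow]
    have hS : (0 : ℝ) ≤ (Fintype.card S : ℝ) ^ Fintype.card I := by positivity
    have hK0 : (0 : ℝ) ≤ Fintype.card K := by positivity
    have := mul_le_mul_of_nonneg_left (mul_le_mul_of_nonneg_left (add_le_add h1 h2) hS) hK0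
    linarith
  obtain ⟨s, -, hs⟩ := Finset.exists_le_of_sum_le Finset.univ_nonempty tot
  refine ⟨s, fun k => ?_⟩
  have hk : Real.exp (l * ∑ i, φ k i (s i)) + Real.exp (-l * ∑ i, φ k i (s i)) ≤
      2 * Fintype.card K * Real.exp (1 / 2) := by
    refine le_trans ?_ hs
    exact Finset.single_le_sum (f := fun k => Real.exp (l * ∑ i, φ k i (s i)) +
      Real.exp (-l * ∑ i, φ k i (s i))) (fun k _ => by positivity) (Finset.mem_univ k)
  have hKp : (0 : ℝ) < 2 * Fintype.card K := by
    have : 0 < Fintype.card K := Fintype.card_pos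
    positivity
  have hexp : 2 * Fintype.card K * Real.exp (1 / 2) =
      Real.exp (Real.log (2 * Fintype.card K) + 1 / 2) := by
    rw [Real.exp_add, Real.exp_log hKp]
  rw [hexp] at hk
  have p1 := (Real.exp_le_exp.1 ((le_add_of_nonneg_right (Real.exp_pos _).le).trans hk))
  have p2 := (Real.exp_le_exp.1 ((le_add_of_nonneg_left (Real.exp_pos _).le).trans hk))
  have hsl : √m * l = 1 := mul_inv_cancel₀ hsm.ne'
  rw [abs_le]
  constructor
  · have := mul_le_mul_of_nonneg_left p2 hsm.le
    nlinarith
  · have := mul_le_mul_of_nonneg_left p1 hsm.le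
    nlinarith

/-- The Walsh matrices. -/
theorem exists_orthogonal_signs (n : ℕ) :
    ∃ w : (Fin n → Bool) → (Fin n → Bool) → ℝ, (∀ i ω, w i ω = 1 ∨ w i ω = -1) ∧
      ∀ i j, i ≠ j → ∑ ω, w i ω * w j ω = 0 := by
  classical
  let s : Bool → Bool → ℝ := fun x y => if x && y then -1 else 1
  refine ⟨fun i ω => ∏ k, s (i k) (ω k), fun i ω => ?_, fun i j hij => ?_⟩
  · refine Finset.prod_induction (fun k => s (i k) (ω k)) (fun r => r = 1 ∨ r = -1) ?_ ?_ ?_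
    · rintro a b (rfl | rfl) (rfl | rfl) <;> simp
    · simp
    · intro k _
      cases h1 : i k <;> cases h2 : ω k <;> simp [s]
  · simp_rw [← Finset.prod_mul_distrib]
    rw [← Fintype.prod_sum (fun k y => s (i k) y * s (j k) y)]
    obtain ⟨k, hk⟩ := Function.ne_iff.1 hij
    refine Finset.prod_eq_zero (Finset.mem_univ k) ?_
    cases h1 : i k <;> cases h2 : j k <;> simp_all [s]

/-- The sign attached to a Boolean. -/
def boolSign (c : Bool) : ℝ := if c then -1 else 1

/-- The twist of the coordinate `t` by two signs. -/
def signTwist (s : Bool × Bool × Bool × Bool) (t : Bool × Bool) : ℝ :=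
  (if t.1 then boolSign s.1 else 1) * (if t.2 then boolSign s.2.1 else 1)

/-- The sign selected by `x` among two signs. -/
def signSelect (s : Bool × Bool × Bool × Bool) (x : Bool) : ℝ :=
  if x then boolSign s.2.2.1 else boolSign s.2.2.2

theorem sum_mul_mul_of_orthogonal {J : Type*} [Fintype J] {w : J → J → ℝ}
    (hw : ∀ i j, i ≠ j → ∑ ω, w i ω * w j ω = 0) (f g : Bool × Bool → ℝ) {i j : J} (hij : i ≠ j) :
    ∑ q : J × Bool × Bool, (f q.2 * w i q.1) * (g q.2 * w j q.1) = 0 := by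
  rw [Fintype.sum_prod_type_right]
  refine Finset.sum_eq_zero fun t _ => ?_
  have : ∀ ω, (f t * w i ω) * (g t * w j ω) = (f t * g t) * (w i ω * w j ω) := fun ω => by ring
  simp_rw [this, ← Finset.mul_sum, hw i j hij, mul_zero]

theorem sum_mul_mul_self {J : Type*} [Fintype J] {w : J → J → ℝ}
    (hw1 : ∀ i ω, w i ω = 1 ∨ w i ω = -1) (f g : Bool × Bool → ℝ) (i : J) :
    ∑ q : J × Bool × Bool, (f q.2 * w i q.1) * (g q.2 * w i q.1) =
      Fintype.card J * ∑ t, f t * g t := by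
  rw [Fintype.sum_prod_type]
  have : ∀ ω t, (f t * w i ω) * (g t * w i ω) = f t * g t := by
    intro ω t
    rcases hw1 i ω with h | h <;> rw [h] <;> ring
  simp_rw [this]
  simp

/-- One level of the construction: two systems `b false`, `b true` indexed by `J` and a system `a`
indexed by a set of twice the size, on the same finite set. -/
theorem exists_sign_level {J J' P : Type*} [Fintype J] [DecidableEq J] [Nonempty J] [Fintype J']
    [DecidableEq J'] [Fintype P]
    (hJ' : Fintype.card J' = 2 * Fintype.card J) (w : J → J → ℝ)
    (hw1 : ∀ i ω, w i ω = 1 ∨ w i ω = -1) (hw : ∀ i j, i ≠ j → ∑ ω, w i ω * w j ω = 0)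
    (α : J → P → ℝ) (hα : ∀ i ω, α i ω = 1 ∨ α i ω = -1) (η : ℝ)
    (hη : √(Fintype.card J) * (Real.log (2 * (8 * Fintype.card J * Fintype.card P +
      28 * Fintype.card J ^ 2 : ℕ)) + 1 / 2) ≤ Fintype.card J * η) :
    ∃ (b : Bool → J → J × Bool × Bool → ℝ) (a : J' → J × Bool × Bool → ℝ),
      (∀ x i ω, b x i ω = 1 ∨ b x i ω = -1) ∧
      (∀ i ω, a i ω = 1 ∨ a i ω = -1) ∧
      (∀ x i j, ∑ ω, b x i ω * b x j ω =
        if i = j then (Fintype.card (J × Bool × Bool) : ℝ) else 0) ∧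
      (∀ i j, ∑ ω, a i ω * a j ω =
        if i = j then (Fintype.card (J × Bool × Bool) : ℝ) else 0) ∧
      (∀ x i j, ∑ ω, b x i ω * a j ω = 0) ∧
      (∀ x ω ω', |(Fintype.card J : ℝ)⁻¹ * ∑ i, b x i ω * α i ω'| ≤ η) ∧
      (∀ x y ω ω', x ≠ y → |(Fintype.card J : ℝ)⁻¹ * ∑ i, b x i ω * b y i ω'| ≤ η) ∧
      (∀ x ω ω', |(Fintype.card J : ℝ)⁻¹ * ∑ i, b x i ω * b x i ω' -
        (Fintype.card J' : ℝ)⁻¹ * ∑ i, a i ω * a i ω'| ≤ 2 * η) := by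
  classical
  have hJ0 : (0 : ℝ) < Fintype.card J := by exact_mod_cast Fintype.card_pos
  have htw : ∀ s t, signTwist s t = 1 ∨ signTwist s t = -1 := by
    rintro ⟨s1, s2, s3, s4⟩ ⟨t1, t2⟩
    cases s1 <;> cases s2 <;> cases t1 <;> cases t2 <;> simp [signTwist, boolSign]
  have hsel : ∀ s x, signSelect s x = 1 ∨ signSelect s x = -1 := by
    rintro ⟨s1, s2, s3, s4⟩ x
    cases s3 <;> cases s4 <;> cases x <;> simp [signSelect, boolSign]
  have hmul : ∀ u v : ℝ, (u = 1 ∨ u = -1) → (v = 1 ∨ v = -1) → (u * v = 1 ∨ u * v = -1) := by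
    rintro u v (rfl | rfl) (rfl | rfl) <;> simp
  have hsq : ∀ u : ℝ, (u = 1 ∨ u = -1) → u * u = 1 := by
    rintro u (rfl | rfl) <;> simp
  let T := {t : (Bool × Bool) × (Bool × Bool) // t.1 ≠ t.2}
  -- The three kinds of sums to be made small: `b` against `α`, `b false` against `b true`, and the
  -- sums `Q` governing the difference between the correlations of `b` and of `a`. The last are
  -- balanced only for distinct `t`; equal `t` cancel exactly below.
  let K := (Bool × (Bool × Bool) × J × P) ⊕
    ((((Bool × Bool) × (Bool × Bool)) × J × J) ⊕ (T × J × J))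
  let φ : K → J → (Bool × Bool × Bool × Bool) → ℝ := fun k i s =>
    match k with
    | .inl (x, t, ω, ω') => (signSelect s x * signTwist s t) * (w i ω * α i ω')
    | .inr (.inl (t, ω, ω')) => ((signSelect s false * signTwist s t.1) *
        (signSelect s true * signTwist s t.2)) * (w i ω * w i ω')
    | .inr (.inr (t, ω, ω')) => (signTwist s t.1.1 * signTwist s t.1.2) * (w i ω * w i ω')
  have hφ1 : ∀ k i s, φ k i s = 1 ∨ φ k i s = -1 := by
    rintro (⟨x, t, ω, ω'⟩ | ⟨t, ω, ω'⟩ | ⟨t, ω, ω'⟩) i s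
    · exact hmul _ _ (hmul _ _ (hsel _ _) (htw _ _)) (hmul _ _ (hw1 _ _) (hα _ _))
    · exact hmul _ _ (hmul _ _ (hmul _ _ (hsel _ _) (htw _ _)) (hmul _ _ (hsel _ _) (htw _ _)))
        (hmul _ _ (hw1 _ _) (hw1 _ _))
    · exact hmul _ _ (hmul _ _ (htw _ _) (htw _ _)) (hmul _ _ (hw1 _ _) (hw1 _ _))
  have hφ0 : ∀ k i, ∑ s, φ k i s = 0 := by
    rintro (⟨x, t, ω, ω'⟩ | ⟨t, ω, ω'⟩ | ⟨⟨⟨t, t'⟩, ht⟩, ω, ω'⟩) i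
    · simp only [φ, ← Finset.sum_mul]
      convert zero_mul _
      rcases t with ⟨t1, t2⟩
      cases x <;> cases t1 <;> cases t2 <;>
        simp [Fintype.sum_prod_type, signTwist, signSelect, boolSign]
    · simp only [φ, ← Finset.sum_mul]
      convert zero_mul _
      rcases t with ⟨⟨t1, t2⟩, ⟨t3, t4⟩⟩
      cases t1 <;> cases t2 <;> cases t3 <;> cases t4 <;>
        simp [Fintype.sum_prod_type, signTwist, signSelect, boolSign]
    · simp only [φ, ← Finset.sum_mul]
      convert zero_mul _
      rcases t with ⟨t1, t2⟩
      rcases t' with ⟨t3, t4⟩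
      cases t1 <;> cases t2 <;> cases t3 <;> cases t4 <;>
        first
        | exact absurd rfl ht
        | norm_num [Fintype.sum_prod_type, signTwist, boolSign]
  have hcard : Fintype.card K = 8 * Fintype.card J * Fintype.card P + 28 * Fintype.card J ^ 2 := by
    have hT : Fintype.card T = 12 := by decide
    simp only [K, Fintype.card_sum, Fintype.card_prod, Fintype.card_bool, hT]
    ring
  obtain ⟨s, hs⟩ := exists_choice_abs_sum_le φ hφ1 hφ0
  have hs' : ∀ k, |(Fintype.card J : ℝ)⁻¹ * ∑ i, φ k i (s i)| ≤ η := by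
    intro k
    have := ((hs k).trans_eq (by rw [hcard])).trans hη
    rw [abs_mul, abs_of_pos (inv_pos.2 hJ0), inv_mul_le_iff₀ hJ0]
    exact this
  have hη0 : 0 ≤ η := by
    have : Nonempty K := ⟨.inr (.inl (((true, true), (true, true)), Classical.arbitrary J,
      Classical.arbitrary J))⟩
    exact (abs_nonneg _).trans (hs' (Classical.arbitrary K))
  let e : J' ≃ J × Bool := Fintype.equivOfCardEq (by simp [hJ', mul_comm])
  -- Two distinct nontrivial characters of the four-point group. They double the size of the system
  -- `a`, and their orthogonality to the constants makes `a` orthogonal to `b`, which shares the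
  -- same twist.
  let χ : Bool → Bool × Bool → ℝ := fun c t => boolSign t.1 * (if c then boolSign t.2 else 1)
  have hχ1 : ∀ c t, χ c t = 1 ∨ χ c t = -1 := by
    rintro c ⟨t1, t2⟩; cases c <;> cases t1 <;> cases t2 <;> simp [χ, boolSign]
  let f : Bool → J → Bool × Bool → ℝ := fun x i t => signSelect (s i) x * signTwist (s i) t
  let g : J × Bool → Bool × Bool → ℝ := fun i t => signTwist (s i.1) t * χ i.2 t
  have hf1 : ∀ x i t, f x i t = 1 ∨ f x i t = -1 := fun x i t => hmul _ _ (hsel _ _) (htw _ _)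
  have hg1 : ∀ i t, g i t = 1 ∨ g i t = -1 := fun i t => hmul _ _ (htw _ _) (hχ1 _ _)
  have hcJ : (Fintype.card (J × Bool × Bool) : ℝ) = Fintype.card J * 4 := by
    simp
  refine ⟨fun x i q => f x i q.2 * w i q.1, fun i q => g (e i) q.2 * w (e i).1 q.1,
    fun x i q => hmul _ _ (hf1 _ _ _) (hw1 _ _), fun i q => hmul _ _ (hg1 _ _) (hw1 _ _),
    ?_, ?_, ?_, ?_, ?_, ?_⟩
  · intro x i j
    split_ifs with h
    · subst h
      rw [sum_mul_mul_self hw1, hcJ]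
      congr 1
      simp_rw [hsq _ (hf1 x i _)]
      simp
    · exact sum_mul_mul_of_orthogonal hw _ _ h
  · intro i j
    beta_reduce
    by_cases h : (e i).1 = (e j).1
    · rw [← h, sum_mul_mul_self hw1, hcJ]
      have e1 : ∀ t, g (e i) t * g (e j) t = χ (e i).2 t * χ (e j).2 t := by
        intro t
        simp only [g, ← h]
        have := hsq _ (htw (s (e i).1) t)
        linear_combination (χ (e i).2 t * χ (e j).2 t) * this
      simp_rw [e1]
      by_cases h2 : (e i).2 = (e j).2
      · have hij : i = j := e.injective (Prod.ext h h2)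
        rw [if_pos hij, ← h2]
        simp_rw [hsq _ (hχ1 _ _)]
        simp
      · have hij : i ≠ j := fun h' => h2 (by rw [h'])
        rw [if_neg hij]
        generalize (e i).2 = c at h2
        generalize (e j).2 = d at h2
        cases c <;> cases d <;> simp [χ, boolSign, Fintype.sum_prod_type] at h2 ⊢
    · have hij : i ≠ j := fun h' => h (by rw [h'])
      rw [if_neg hij]
      exact sum_mul_mul_of_orthogonal hw _ _ h
  · intro x i j
    beta_reduce
    by_cases h : i = (e j).1
    · rw [h, sum_mul_mul_self hw1]
      have e1 : ∀ t, f x (e j).1 t * g (e j) t = signSelect (s (e j).1) x * χ (e j).2 t := by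
        intro t
        have := hsq _ (htw (s (e j).1) t)
        simp only [f, g]
        linear_combination (signSelect (s (e j).1) x * χ (e j).2 t) * this
      simp_rw [e1, ← Finset.mul_sum]
      have : ∑ t, χ (e j).2 t = 0 := by
        generalize (e j).2 = c
        cases c <;> simp [χ, boolSign, Fintype.sum_prod_type]
      rw [this]; simp
    · exact sum_mul_mul_of_orthogonal hw _ _ h
  · rintro x ⟨ω, t⟩ ω'
    convert hs' (.inl (x, t, ω, ω')) using 4 with i
    simp only [φ, f]; ring
  · rintro x y ⟨ω, t⟩ ⟨ω', t'⟩ hxy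
    cases x <;> cases y <;> simp only [ne_eq, not_true_eq_false] at hxy
    · convert hs' (.inr (.inl ((t, t'), ω, ω'))) using 4 with i
      simp only [φ, f]; ring
    · convert hs' (.inr (.inl ((t', t), ω', ω))) using 4 with i
      simp only [φ, f]; ring
  · rintro x ⟨ω, t⟩ ⟨ω', t'⟩
    have hb : ∀ i, (f x i t * w i ω) * (f x i t' * w i ω') =
        (signTwist (s i) t * signTwist (s i) t') * (w i ω * w i ω') := by
      intro i
      have := hsq _ (hsel (s i) x)
      simp only [f]
      linear_combination (signTwist (s i) t * signTwist (s i) t') * (w i ω * w i ω') * this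
    have ha : ∑ i, (g (e i) t * w (e i).1 ω) * (g (e i) t' * w (e i).1 ω') =
        (∑ c, χ c t * χ c t') *
          ∑ i, (signTwist (s i) t * signTwist (s i) t') * (w i ω * w i ω') := by
      rw [Equiv.sum_comp e (fun i => (g i t * w i.1 ω) * (g i t' * w i.1 ω')),
        Fintype.sum_prod_type_right, Finset.sum_mul]
      refine Finset.sum_congr rfl fun c _ => ?_
      rw [Finset.mul_sum]
      refine Finset.sum_congr rfl fun i _ => ?_
      simp only [g]; ring
    simp only [hb, ha, hJ']
    set Q := ∑ i, (signTwist (s i) t * signTwist (s i) t') * (w i ω * w i ω') with hQ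
    have e2 : (Fintype.card J : ℝ)⁻¹ * Q - ((2 * Fintype.card J : ℕ) : ℝ)⁻¹ *
        ((∑ c, χ c t * χ c t') * Q) =
        (1 - (∑ c, χ c t * χ c t') / 2) * ((Fintype.card J : ℝ)⁻¹ * Q) := by
      push_cast
      field_simp
    rw [e2]
    by_cases h : t = t'
    · subst h
      simp_rw [hsq _ (hχ1 _ _)]
      simp [hη0]
    · have h3 : |(Fintype.card J : ℝ)⁻¹ * Q| ≤ η := hs' (.inr (.inr (⟨(t, t'), h⟩, ω, ω')))
      have h4 : |1 - (∑ c, χ c t * χ c t') / 2| ≤ 2 := by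
        rcases t with ⟨t1, t2⟩
        rcases t' with ⟨t3, t4⟩
        cases t1 <;> cases t2 <;> cases t3 <;> cases t4 <;>
          norm_num [χ, boolSign]
      rw [abs_mul]
      gcongr

/-- Systems of unimodular orthogonal functions: `a n` and `b n t` are indexed by `I n`, live on
`Ω n` and on `Ω (n + 1)`, and have small averaged correlations. -/
structure SignSystem (𝕜 : Type*) [RCLike 𝕜] (I Ω : ℕ → Type) [∀ n, Fintype (I n)]
    [∀ n, DecidableEq (I n)] [∀ n, Fintype (Ω n)] where
  a : ∀ n, I n → Ω n → 𝕜
  b : ∀ n, Bool → I n → Ω (n + 1) → 𝕜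
  η : ℕ → ℝ
  norm_a : ∀ n i ω, ‖a n i ω‖ = 1
  norm_b : ∀ n t i ω, ‖b n t i ω‖ = 1
  sum_a_a : ∀ n i j, ∑ ω, a n i ω * a n j ω = if i = j then (Fintype.card (Ω n) : 𝕜) else 0
  sum_b_b : ∀ n t i j, ∑ ω, b n t i ω * b n t j ω =
    if i = j then (Fintype.card (Ω (n + 1)) : 𝕜) else 0
  sum_b_a : ∀ n t i j, ∑ ω, b n t i ω * a (n + 1) j ω = 0
  avg_b_a : ∀ n t ω ω', ‖(Fintype.card (I n) : 𝕜)⁻¹ * ∑ i, b n t i ω * a n i ω'‖ ≤ η n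
  avg_b_b : ∀ n t t' ω ω', t ≠ t' →
    ‖(Fintype.card (I n) : 𝕜)⁻¹ * ∑ i, b n t i ω * b n t' i ω'‖ ≤ η n
  avg_sub : ∀ n t ω ω', ‖(Fintype.card (I n) : 𝕜)⁻¹ * ∑ i, b n t i ω * b n t i ω' -
    (Fintype.card (I (n + 1)) : 𝕜)⁻¹ * ∑ i, a (n + 1) i ω * a (n + 1) i ω'‖ ≤ η n

/-- The error attached to the passage from level `n` to level `n + 1`. -/
noncomputable def SignSystem.error {𝕜 : Type*} [RCLike 𝕜] {I Ω : ℕ → Type} [∀ n, Fintype (I n)]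
    [∀ n, DecidableEq (I n)] [∀ n, Fintype (Ω n)] (S : SignSystem 𝕜 I Ω) (θ : ℝ) (n : ℕ) : ℝ :=
  S.η n * (Fintype.card (Ω n) : ℝ) ^ θ + S.η n * (Fintype.card (Ω (n + 1)) : ℝ) ^ θ +
    S.η (n + 1) * (Fintype.card (Ω (n + 2)) : ℝ) ^ θ

/-- With `c ≤ 2 ^ (m + 1)` the argument of the logarithm is at most `88 * 4 ^ m ≤ 2 ^ (7 + 2 * m)`;
as `log 2 ≤ 1`, the bracket is below `2 * m + 8`. -/
theorem sign_level_bound (m c : ℕ) (hc : c ≤ 2 ^ (m + 1)) :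
    √(Fintype.card (Fin m → Bool)) * (Real.log (2 * (8 * Fintype.card (Fin m → Bool) * c +
      28 * Fintype.card (Fin m → Bool) ^ 2 : ℕ)) + 1 / 2) ≤
      Fintype.card (Fin m → Bool) * ((2 * m + 8) / √(2 ^ m)) := by
  have hcard : Fintype.card (Fin m → Bool) = 2 ^ m := by simp
  rw [hcard]
  have h1 : 2 * (8 * 2 ^ m * c + 28 * (2 ^ m) ^ 2) ≤ 2 ^ (7 + 2 * m) := by
    have : 2 ^ m * c ≤ 2 ^ m * 2 ^ (m + 1) := Nat.mul_le_mul_left _ hc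
    have e1 : (2 : ℕ) ^ (7 + 2 * m) = 128 * (2 ^ m * 2 ^ m) := by
      rw [pow_add, two_mul, pow_add]; norm_num
    have e2 : 2 ^ m * 2 ^ (m + 1) = 2 * (2 ^ m * 2 ^ m) := by ring
    have e3 : (2 ^ m) ^ 2 = 2 ^ m * 2 ^ m := by ring
    rw [e1, e3]
    nlinarith
  have h2 : Real.log (2 * (8 * 2 ^ m * c + 28 * (2 ^ m) ^ 2 : ℕ)) ≤ 7 + 2 * m := by
    have h3 : (2 * (8 * 2 ^ m * c + 28 * (2 ^ m) ^ 2 : ℕ) : ℝ) ≤ (2 : ℝ) ^ (7 + 2 * m) := by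
      exact_mod_cast h1
    have h0 : (0 : ℝ) < 2 * (8 * 2 ^ m * c + 28 * (2 ^ m) ^ 2 : ℕ) := by positivity
    refine (Real.log_le_log h0 h3).trans ?_
    rw [Real.log_pow]
    have : Real.log 2 ≤ 1 := by linarith [Real.log_two_lt_d9]
    have h4 : (0 : ℝ) ≤ ((7 + 2 * m : ℕ) : ℝ) := by positivity
    have := mul_le_mul_of_nonneg_left this h4
    push_cast at this ⊢
    linarith
  have hs : (0 : ℝ) < √(2 ^ m) := by positivity
  have e : (((2 ^ m : ℕ) : ℝ)) * ((2 * m + 8) / √(2 ^ m)) = √(2 ^ m) * (2 * m + 8) := by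
    have : (2 : ℝ) ^ m = √(2 ^ m) * √(2 ^ m) := (Real.mul_self_sqrt (by positivity)).symm
    push_cast
    field_simp
    rw [Real.sq_sqrt (by positivity)]
  rw [e]
  push_cast at h2 ⊢
  refine mul_le_mul_of_nonneg_left ?_ hs.le
  linarith

/-- The terms are of order `n * 2 ^ ((θ - 1/2) * n)`. This is where `θ < 1 / 2`, that is `p > 2`, is
decisive. -/
theorem summable_sign_error (θ : ℝ) (hθ : θ < 1 / 2) (k : ℕ) :
    Summable fun n : ℕ => (2 * ((2 * (n + 1 : ℕ) + 8) / √(2 ^ (n + 1)))) *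
      ((2 : ℝ) ^ (n + k) * 4) ^ θ := by
  set r : ℝ := 2 ^ (θ - 1 / 2) with hr
  have hr0 : 0 < r := by positivity
  have hr1 : r < 1 := Real.rpow_lt_one_of_one_lt_of_neg one_lt_two (by linarith)
  have hsum : Summable fun n : ℕ => ((n : ℝ) + 5) * r ^ n := by
    have h1 := summable_pow_mul_geometric_of_norm_lt_one (R := ℝ) 1 (r := r)
      (by rwa [Real.norm_of_nonneg hr0.le])
    have h2 := (summable_geometric_of_lt_one hr0.le hr1).mul_left 5
    refine (h1.add h2).congr fun n => ?_
    ring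
  refine (hsum.mul_left (4 / √2 * ((2 : ℝ) ^ k * 4) ^ θ)).congr fun n => ?_
  have e1 : ((2 : ℝ) ^ (n + k) * 4) ^ θ = ((2 : ℝ) ^ k * 4) ^ θ * ((2 : ℝ) ^ θ) ^ n := by
    rw [pow_add, mul_assoc, Real.mul_rpow (by positivity) (by positivity), mul_comm]
    congr 1
    rw [← Real.rpow_natCast, ← Real.rpow_mul (by positivity), mul_comm, Real.rpow_mul (by positivity),
      Real.rpow_natCast]
  have e2 : √((2 : ℝ) ^ (n + 1)) = √2 * √2 ^ n := by
    rw [pow_succ, Real.sqrt_mul (by positivity), mul_comm, Real.sqrt_eq_rpow, Real.sqrt_eq_rpow,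
      ← Real.rpow_natCast, ← Real.rpow_natCast, ← Real.rpow_mul (by positivity),
      ← Real.rpow_mul (by positivity)]
    ring_nf
  have e3 : r ^ n = ((2 : ℝ) ^ θ) ^ n / √2 ^ n := by
    rw [hr, Real.rpow_sub (by positivity), div_pow, ← Real.sqrt_eq_rpow]
  have hs : (0 : ℝ) < √2 := by positivity
  rw [e1, e2, e3]
  push_cast
  field_simp
  ring

/-- The levels are chosen recursively: the system `a n` already built serves as `α` in
`exists_sign_level`, which returns `b n` and `a (n + 1)` together. -/
theorem exists_signSystem (𝕜 : Type*) [RCLike 𝕜] (θ : ℝ) (hθ : θ < 1 / 2) :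
    ∃ S : SignSystem 𝕜 (fun n => Fin (n + 1) → Bool) (fun n => (Fin n → Bool) × Bool × Bool),
      Summable (S.error θ) := by
  choose w hw1 hw using exists_orthogonal_signs
  let I : ℕ → Type := fun n => Fin (n + 1) → Bool
  let Ω : ℕ → Type := fun n => (Fin n → Bool) × Bool × Bool
  let A : ℕ → Type := fun n => {a : I n → Ω n → ℝ // (∀ i ω, a i ω = 1 ∨ a i ω = -1) ∧
    ∀ i j, ∑ ω, a i ω * a j ω = if i = j then (Fintype.card (Ω n) : ℝ) else 0}
  let ζ : ℕ → ℝ := fun m => (2 * m + 8) / √(2 ^ m)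
  have hζ : ∀ m, 0 ≤ ζ m := fun m => by positivity
  have hcard : ∀ m, Fintype.card (Fin (m + 1) → Bool) = 2 * Fintype.card (Fin m → Bool) := by
    intro m; simp [pow_succ, mul_comm]
  have start : Nonempty (A 0) := by
    -- There is no earlier system at the start, so `α` is a dummy constant.
    obtain ⟨b, a, h1, h2, h3, h4, -⟩ := exists_sign_level (J := Fin 0 → Bool)
      (J' := Fin 1 → Bool) (P := Unit) (hcard 0) (w 0) (hw1 0) (hw 0) (fun _ _ => 1) (by simp)
      (ζ 0) (sign_level_bound 0 _ (by simp))
    exact ⟨⟨a, h2, h4⟩⟩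
  have step : ∀ n (a : A n), ∃ (a' : A (n + 1)) (b : Bool → I n → Ω (n + 1) → ℝ),
      (∀ x i ω, b x i ω = 1 ∨ b x i ω = -1) ∧
      (∀ x i j, ∑ ω, b x i ω * b x j ω = if i = j then (Fintype.card (Ω (n + 1)) : ℝ) else 0) ∧
      (∀ x i j, ∑ ω, b x i ω * a'.1 j ω = 0) ∧
      (∀ x ω ω', |(Fintype.card (I n) : ℝ)⁻¹ * ∑ i, b x i ω * a.1 i ω'| ≤ ζ (n + 1)) ∧
      (∀ x y ω ω', x ≠ y → |(Fintype.card (I n) : ℝ)⁻¹ * ∑ i, b x i ω * b y i ω'| ≤ ζ (n + 1)) ∧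
      (∀ x ω ω', |(Fintype.card (I n) : ℝ)⁻¹ * ∑ i, b x i ω * b x i ω' -
        (Fintype.card (I (n + 1)) : ℝ)⁻¹ * ∑ i, a'.1 i ω * a'.1 i ω'| ≤ 2 * ζ (n + 1)) := by
    intro n a
    obtain ⟨b, a', h1, h2, h3, h4, h5, h6, h7, h8⟩ := exists_sign_level (J := Fin (n + 1) → Bool)
      (J' := Fin (n + 2) → Bool) (P := Ω n) (hcard (n + 1)) (w (n + 1)) (hw1 (n + 1))
      (hw (n + 1)) a.1 a.2.1 (ζ (n + 1))
      (by
        have := sign_level_bound (n + 1) (Fintype.card (Ω n)) (by simp [Ω, pow_succ]; omega)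
        exact this)
    exact ⟨⟨a', h2, h4⟩, b, h1, h3, h5, h6, h7, h8⟩
  choose nxt B hB1 hB2 hB3 hB4 hB5 hB6 using step
  let a : ∀ n, A n := fun n => Nat.rec (Classical.choice start) (fun n a => nxt n a) n
  have ha : ∀ n, a (n + 1) = nxt n (a n) := fun n => rfl
  have hn1 : ∀ r : ℝ, (r = 1 ∨ r = -1) → ‖(r : 𝕜)‖ = 1 := by
    rintro r (rfl | rfl) <;> simp
  have hle : ∀ n, ζ (n + 1) ≤ 2 * ζ (n + 1) := fun n => by linarith [hζ (n + 1)]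
  let S : SignSystem 𝕜 I Ω :=
    { a := fun n i ω => ((a n).1 i ω : 𝕜)
      b := fun n t i ω => (B n (a n) t i ω : 𝕜)
      η := fun n => 2 * ζ (n + 1)
      norm_a := fun n i ω => hn1 _ ((a n).2.1 i ω)
      norm_b := fun n t i ω => hn1 _ (hB1 _ _ _ _ _)
      sum_a_a := fun n i j => by
        have := congrArg (fun r : ℝ => (r : 𝕜)) ((a n).2.2 i j)
        split_ifs at this ⊢ <;> simpa using this
      sum_b_b := fun n t i j => by
        have := congrArg (fun r : ℝ => (r : 𝕜)) (hB2 n (a n) t i j)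
        split_ifs at this ⊢ <;> simpa using this
      sum_b_a := fun n t i j => by
        have := congrArg (fun r : ℝ => (r : 𝕜)) (hB3 n (a n) t i j)
        rw [← ha] at this
        simpa using this
      avg_b_a := fun n t ω ω' => by
        have := (hB4 n (a n) t ω ω').trans (hle n)
        rw [← RCLike.norm_ofReal (K := 𝕜)] at this
        simpa using this
      avg_b_b := fun n t t' ω ω' h => by
        have := (hB5 n (a n) t t' ω ω' h).trans (hle n)
        rw [← RCLike.norm_ofReal (K := 𝕜)] at this
        simpa using this
      avg_sub := fun n t ω ω' => by
        have := hB6 n (a n) t ω ω'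
        rw [← RCLike.norm_ofReal (K := 𝕜), ← ha] at this
        simpa using this }
  refine ⟨S, ?_⟩
  have hΩ : ∀ n, (Fintype.card (Ω n) : ℝ) = 2 ^ n * 4 := by
    intro n; simp [Ω]
  have s0 := summable_sign_error θ hθ 0
  have s1 := summable_sign_error θ hθ 1
  have s2 := (summable_nat_add_iff 1).2 s1
  refine ((s0.add s1).add s2).congr fun n => ?_
  have hη : ∀ n, S.η n = 2 * ((2 * (n + 1 : ℕ) + 8) / √(2 ^ (n + 1))) := fun n => rfl
  simp only [SignSystem.error, hη]
  erw [hΩ n, hΩ (n + 1), hΩ (n + 2)]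
  rfl

/-! ### Blocks of `ℓ_p` in a space in which `ℓ_p` is crudely finitely representable -/

/-- Hahn–Banach in the quotient by `W`, where the class of `v` has norm at least `r`. -/
theorem exists_functional_of_le_norm_sub {𝕜 X : Type*} [RCLike 𝕜] [NormedAddCommGroup X]
    [NormedSpace 𝕜 X] (W : Submodule 𝕜 X) (v : X) {r : ℝ} (hr : 0 < r)
    (h : ∀ w ∈ W, r ≤ ‖v - w‖) :
    ∃ f : X →L[𝕜] 𝕜, f v = 1 ∧ (∀ w ∈ W, f w = 0) ∧ ‖f‖ ≤ r⁻¹ := by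
  have hq : r ≤ ‖W.mkQL v‖ := by
    have : ‖W.mkQL v‖ = Metric.infDist v W := QuotientAddGroup.norm_mk (S := W.toAddSubgroup) v
    rw [this]
    refine (Metric.le_infDist ⟨0, W.zero_mem⟩).2 fun w hw => ?_
    rw [dist_eq_norm]
    exact h w hw
  have hq0 : 0 < ‖W.mkQL v‖ := hr.trans_le hq
  obtain ⟨g, hg1, hg2⟩ := exists_dual_vector 𝕜 (W.mkQL v) hq0.ne'
  refine ⟨((‖W.mkQL v‖ : 𝕜)⁻¹) • (g.comp W.mkQL), ?_, fun w hw => ?_, ?_⟩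
  · have : (‖W.mkQL v‖ : 𝕜) ≠ 0 := by exact_mod_cast hq0.ne'
    simp only [smul_apply, ContinuousLinearMap.comp_apply, hg2, smul_eq_mul]
    exact inv_mul_cancel₀ this
  · have : W.mkQL w = 0 := by simpa using hw
    simp [ContinuousLinearMap.comp_apply, this]
  · refine ContinuousLinearMap.opNorm_le_bound _ (by positivity) fun x => ?_
    simp only [smul_apply, ContinuousLinearMap.comp_apply, norm_smul, norm_inv,
      RCLike.norm_ofReal, abs_norm]
    have h1 : ‖g (W.mkQL x)‖ ≤ ‖x‖ := by
      refine (g.le_opNorm _).trans ?_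
      rw [hg1, one_mul]
      exact QuotientAddGroup.norm_mk_le_norm (S := W.toAddSubgroup)
    gcongr

/-- Compactness of the unit sphere of `E`. Vectors killed by `Ψ` are then almost orthogonal to `E`,
as in Mazur's construction of basic sequences. -/
theorem exists_finset_norming {𝕜 X : Type*} [RCLike 𝕜] [NormedAddCommGroup X] [NormedSpace 𝕜 X]
    (E : Submodule 𝕜 X) [FiniteDimensional 𝕜 E] :
    ∃ Ψ : Finset (X →L[𝕜] 𝕜), (∀ ψ ∈ Ψ, ‖ψ‖ ≤ 1) ∧ ∀ v ∈ E, ∃ ψ ∈ Ψ, ‖v‖ ≤ 2 * ‖ψ v‖ := by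
  classical
  have : ProperSpace E := FiniteDimensional.proper 𝕜 E
  have hc : IsCompact (Metric.sphere (0 : E) 1) := isCompact_sphere 0 1
  choose ψ hψ1 hψ2 using fun v : E => exists_dual_vector'' 𝕜 (v : X)
  obtain ⟨t, ht⟩ := hc.elim_finite_subcover (fun v : E => {u : E | 1 / 2 < ‖ψ v u‖})
    (fun v => isOpen_lt continuous_const (by fun_prop)) (fun v hv => by
      have : ‖(v : X)‖ = 1 := by simpa using hv
      refine Set.mem_iUnion.2 ⟨v, ?_⟩
      simp only [Set.mem_ofPred_eq, hψ2, this]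
      norm_num)
  refine ⟨insert 0 (t.image ψ), ?_, fun v hv => ?_⟩
  · intro f hf
    rcases Finset.mem_insert.1 hf with rfl | hf
    · simp
    · obtain ⟨v, -, rfl⟩ := Finset.mem_image.1 hf
      exact hψ1 v
  · by_cases h0 : v = 0
    · exact ⟨0, Finset.mem_insert_self _ _, by simp [h0]⟩
    · have hn : 0 < ‖v‖ := norm_pos_iff.2 h0
      have hu : ((‖v‖ : 𝕜)⁻¹) • (⟨v, hv⟩ : E) ∈ Metric.sphere (0 : E) 1 := by
        simp [norm_smul, hn.ne']
      obtain ⟨u, hut, hu⟩ := Set.mem_iUnion₂.1 (ht hu)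
      refine ⟨ψ u, Finset.mem_insert_of_mem (Finset.mem_image_of_mem _ hut), ?_⟩
      simp only [Set.mem_ofPred_eq, Submodule.coe_smul, map_smul, norm_smul, norm_inv,
        RCLike.norm_ofReal, abs_norm] at hu
      rw [inv_mul_eq_div, lt_div_iff₀ hn] at hu
      linarith

section Disjoint

variable {𝕜 : Type*} [RCLike 𝕜] {p : ℝ≥0∞} {Ω : Type*} [Fintype Ω]
  {f : Ω → lp (fun _ : ℕ => 𝕜) p}

theorem lp_sum_smul_apply_eq (hf : ∀ m ω ω', ω ≠ ω' → f ω m = 0 ∨ f ω' m = 0) (c : Ω → 𝕜) {m : ℕ}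
    {ω : Ω} (h : f ω m ≠ 0) : (∑ ω, c ω • f ω) m = c ω * f ω m := by
  classical
  rw [lp.coeFn_sum, Finset.sum_apply, Finset.sum_eq_single ω]
  · simp
  · intro ω' _ hω'
    have := (hf m ω' ω hω').resolve_right h
    simp [this]
  · simp

theorem norm_le_lp_sum_smul [Fact (1 ≤ p)]
    (hf : ∀ m ω ω', ω ≠ ω' → f ω m = 0 ∨ f ω' m = 0)
    (h1 : ∀ ω, ‖f ω‖ = 1) (c : Ω → 𝕜) (ω : Ω) : ‖c ω‖ ≤ ‖∑ ω, c ω • f ω‖ := by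
  have hp : p ≠ 0 := (zero_lt_one.trans_le (Fact.out : 1 ≤ p)).ne'
  have : ‖c ω‖ = ‖c ω • f ω‖ := by rw [norm_smul, h1, mul_one]
  rw [this]
  refine lp.norm_mono hp fun m => ?_
  by_cases h : f ω m = 0
  · simp [h]
  · rw [lp_sum_smul_apply_eq hf c h]
    simp

theorem lp_norm_sum_smul_le [Fact (1 ≤ p)]
    (hf : ∀ m ω ω', ω ≠ ω' → f ω m = 0 ∨ f ω' m = 0)
    (h1 : ∀ ω, ‖f ω‖ = 1) (c : Ω → 𝕜) {B : ℝ} (hB : 0 ≤ B) (hc : ∀ ω, ‖c ω‖ ≤ B) :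
    ‖∑ ω, c ω • f ω‖ ≤ (Fintype.card Ω : ℝ) ^ (p.toReal⁻¹) * B := by
  have hp1 : 1 ≤ p := Fact.out
  have hp : p ≠ 0 := (zero_lt_one.trans_le hp1).ne'
  have pt : ∀ m, (∃ ω, f ω m ≠ 0) ∨ (∑ ω, c ω • f ω) m = 0 := by
    intro m
    by_cases h : ∃ ω, f ω m ≠ 0
    · exact .inl h
    · push Not at h
      refine .inr ?_
      rw [lp.coeFn_sum, Finset.sum_apply]
      exact Finset.sum_eq_zero fun ω _ => by simp [h]
  rcases eq_or_ne p ∞ with rfl | hpt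
  -- For `p = ∞` the convention `∞.toReal⁻¹ = 0` gives the correct exponent.
  · simp only [ENNReal.toReal_top, inv_zero, Real.rpow_zero, one_mul]
    refine lp.norm_le_of_forall_le hB fun m => ?_
    rcases pt m with ⟨ω, h⟩ | h
    · rw [lp_sum_smul_apply_eq hf c h, norm_mul]
      have := (lp.norm_apply_le_norm hp (f ω) m).trans_eq (h1 ω)
      nlinarith [hc ω, norm_nonneg (c ω), norm_nonneg (f ω m)]
    · rw [h]; simpa using hB
  · have hp0 : 0 < p.toReal := ENNReal.toReal_pos hp hpt
    refine lp.norm_le_of_forall_sum_le hp0 (by positivity) fun s => ?_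
    rw [Real.mul_rpow (by positivity) hB, ← Real.rpow_mul (by positivity),
      inv_mul_cancel₀ hp0.ne', Real.rpow_one]
    calc ∑ m ∈ s, ‖(∑ ω, c ω • f ω) m‖ ^ p.toReal
        ≤ ∑ m ∈ s, ∑ ω, (B * ‖f ω m‖) ^ p.toReal := by
          refine Finset.sum_le_sum fun m _ => ?_
          rcases pt m with ⟨ω, h⟩ | h
          · rw [lp_sum_smul_apply_eq hf c h, norm_mul]
            refine le_trans ?_ (Finset.single_le_sum
              (f := fun ω => (B * ‖f ω m‖) ^ p.toReal) (fun ω _ => by positivity)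
              (Finset.mem_univ ω))
            gcongr
            exact hc ω
          · rw [h, norm_zero, Real.zero_rpow hp0.ne']
            exact Finset.sum_nonneg fun ω _ => by positivity
      _ = ∑ ω, B ^ p.toReal * ∑ m ∈ s, ‖f ω m‖ ^ p.toReal := by
          rw [Finset.sum_comm]
          refine Finset.sum_congr rfl fun ω _ => ?_
          rw [Finset.mul_sum]
          refine Finset.sum_congr rfl fun m _ => ?_
          rw [Real.mul_rpow hB (norm_nonneg _)]
      _ ≤ ∑ _ω : Ω, B ^ p.toReal * 1 := by
          refine Finset.sum_le_sum fun ω _ => ?_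
          have := lp.sum_rpow_le_norm_rpow hp0 (f ω) s
          rw [h1, Real.one_rpow] at this
          gcongr
      _ = Fintype.card Ω * B ^ p.toReal := by simp

end Disjoint

/-- Disjointly supported normalized sequences in the kernel of finitely many functionals of a
linear image of the finitely supported sequences. -/
theorem exists_disjoint_of_functionals {𝕜 X : Type*} [RCLike 𝕜] [NormedAddCommGroup X]
    [NormedSpace 𝕜 X] {p : ℝ≥0∞} [Fact (1 ≤ p)] {K : ℝ}
    (hK : CrudelyFinitelyRepresentableWith 𝕜 (lp (fun _ : ℕ => 𝕜) p) X K)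
    (Φ : Finset (X →L[𝕜] 𝕜)) (Ω : Type*) [Fintype Ω] [DecidableEq Ω] :
    ∃ e : Ω → X, (∀ φ ∈ Φ, ∀ ω, φ (e ω) = 0) ∧
      (∀ (c : Ω → 𝕜) ω, ‖c ω‖ ≤ K * ‖∑ ω, c ω • e ω‖) ∧
      ∀ (c : Ω → 𝕜) (B : ℝ), 0 ≤ B → (∀ ω, ‖c ω‖ ≤ B) →
        ‖∑ ω, c ω • e ω‖ ≤ (Fintype.card Ω : ℝ) ^ (p.toReal⁻¹) * B := by
  classical
  -- One more coordinate than functionals, so that each group of coordinates carries a nonzero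
  -- vector whose image lies in the kernel of all of `Φ`.
  let J := Fin (Φ.card + 1)
  let k : Ω × J → ℕ := fun q => (Fintype.equivFin (Ω × J) q : ℕ)
  have hk : Function.Injective k := Fin.val_injective.comp (Equiv.injective _)
  let g : Ω × J → lp (fun _ : ℕ => 𝕜) p := fun q => lp.single p (k q) 1
  let F : Submodule 𝕜 (lp (fun _ : ℕ => 𝕜) p) := Submodule.span 𝕜 (Set.range g)
  have hF : FiniteDimensional 𝕜 F := FiniteDimensional.span_of_finite 𝕜 (Set.finite_range g)
  obtain ⟨G, T, hT⟩ := hK F hF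
  have hg : ∀ q, g q ∈ F := fun q => Submodule.subset_span ⟨q, rfl⟩
  let gF : Ω × J → F := fun q => ⟨g q, hg q⟩
  have hα : ∀ ω, ∃ α : J → 𝕜, α ≠ 0 ∧ ∀ φ ∈ Φ, φ (T (∑ j, α j • gF (ω, j)) : G) = 0 := by
    intro ω
    let L : (J → 𝕜) →ₗ[𝕜] (Φ → 𝕜) := LinearMap.pi fun φ : Φ =>
      ((φ : X →L[𝕜] 𝕜) : X →ₗ[𝕜] 𝕜) ∘ₗ G.subtype ∘ₗ (T.toLinearEquiv : F →ₗ[𝕜] G) ∘ₗ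
        (Fintype.linearCombination 𝕜 (fun j => gF (ω, j)))
    have hL : LinearMap.ker L ≠ ⊥ := LinearMap.ker_ne_bot_of_finrank_lt (by simp [J])
    obtain ⟨α, hα, hα0⟩ := Submodule.exists_mem_ne_zero_of_ne_bot hL
    refine ⟨α, hα0, fun φ hφ => ?_⟩
    have := congrFun (LinearMap.mem_ker.1 hα) ⟨φ, hφ⟩
    simpa [L, Fintype.linearCombination_apply] using this
  choose α hα0 hα using hα
  let f' : Ω → F := fun ω => ∑ j, α ω j • gF (ω, j)
  have hf'c : ∀ ω, ((f' ω : F) : lp (fun _ : ℕ => 𝕜) p) = ∑ j, α ω j • g (ω, j) := by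
    intro ω; simp [f', gF]
  have happ : ∀ ω m, (f' ω : lp (fun _ : ℕ => 𝕜) p) m =
      ∑ j, α ω j * (if m = k (ω, j) then 1 else 0) := by
    intro ω m
    rw [hf'c, lp.coeFn_sum, Finset.sum_apply]
    refine Finset.sum_congr rfl fun j _ => ?_
    simp [g, lp.single_apply, Pi.single_apply]
  have hf'0 : ∀ ω, f' ω ≠ 0 := by
    intro ω h
    obtain ⟨j, hj⟩ := Function.ne_iff.1 (hα0 ω)
    apply hj
    have h1 := happ ω (k (ω, j))
    rw [h, Finset.sum_eq_single j] at h1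
    · simpa using h1.symm
    · intro j' _ hj'
      have : k (ω, j) ≠ k (ω, j') := fun h => hj' (congrArg Prod.snd (hk h)).symm
      simp [this]
    · simp
  have hdis : ∀ m ω ω', ω ≠ ω' → (f' ω : lp (fun _ : ℕ => 𝕜) p) m = 0 ∨
      (f' ω' : lp (fun _ : ℕ => 𝕜) p) m = 0 := by
    intro m ω ω' hne
    by_cases h : ∃ j, m = k (ω, j)
    · obtain ⟨j, rfl⟩ := h
      right
      rw [happ]
      refine Finset.sum_eq_zero fun j' _ => ?_
      have : k (ω, j) ≠ k (ω', j') := fun h => hne (congrArg Prod.fst (hk h))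
      simp [this]
    · left
      push Not at h
      rw [happ]
      exact Finset.sum_eq_zero fun j' _ => by simp [h j']
  let fF : Ω → F := fun ω => ((‖f' ω‖ : 𝕜)⁻¹) • f' ω
  let f : Ω → lp (fun _ : ℕ => 𝕜) p := fun ω => (fF ω : lp (fun _ : ℕ => 𝕜) p)
  have hf1 : ∀ ω, ‖f ω‖ = 1 := by
    intro ω
    have : ‖f' ω‖ ≠ 0 := norm_ne_zero_iff.2 (hf'0 ω)
    have h2 : ‖fF ω‖ = 1 := by
      rw [norm_smul, norm_inv, RCLike.norm_ofReal, abs_norm, inv_mul_cancel₀ this]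
    exact h2
  have hfd : ∀ m ω ω', ω ≠ ω' → f ω m = 0 ∨ f ω' m = 0 := by
    intro m ω ω' hne
    rcases hdis m ω ω' hne with h | h
    · left; simp [f, fF, h]
    · right; simp [f, fF, h]
  set N : ℝ := ‖(T : F →L[𝕜] G)‖ with hN
  have hsum : ∀ c : Ω → 𝕜, ‖∑ ω, c ω • f ω‖ = ‖∑ ω, c ω • fF ω‖ := by
    intro c
    have : ((∑ ω, c ω • fF ω : F) : lp (fun _ : ℕ => 𝕜) p) = ∑ ω, c ω • f ω := by simp [f]
    rw [← this]; rfl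
  -- Dividing by `‖T‖` makes the upper estimate hold with constant `1`, leaving the distortion `K`
  -- to the lower one.
  let e : Ω → X := fun ω => ((N : 𝕜)⁻¹) • ((T (fF ω) : G) : X)
  have hesum : ∀ c : Ω → 𝕜, ∑ ω, c ω • e ω = ((N : 𝕜)⁻¹) • ((T (∑ ω, c ω • fF ω) : G) : X) := by
    intro c
    simp only [e, map_sum, map_smul, AddSubmonoidClass.coe_finsetSum, Submodule.coe_smul,
      Finset.smul_sum]
    exact Finset.sum_congr rfl fun ω _ => smul_comm _ _ _
  refine ⟨e, fun φ hφ ω => ?_, fun c ω => ?_, fun c B hB hc => ?_⟩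
  · have := hα ω φ hφ
    simp only [e, fF, map_smul, Submodule.coe_smul, f']
    rw [this]; simp
  · have hN0 : 0 < N := by
      rcases (norm_nonneg (T : F →L[𝕜] G)).eq_or_lt with h | h
      · exfalso
        have h3 := (T : F →L[𝕜] G).le_opNorm (fF ω)
        rw [← h, zero_mul] at h3
        have h4 : T (fF ω) = 0 := norm_le_zero_iff.1 h3
        have h5 : fF ω = 0 := by simpa using h4
        have h6 := hf1 ω
        simp [f, h5] at h6
      · exact h
    refine (norm_le_lp_sum_smul hfd hf1 c ω).trans ?_
    rw [hsum, hesum, norm_smul]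
    set v : F := ∑ ω, c ω • fF ω
    have h1 : ‖v‖ ≤ ‖(T.symm : G →L[𝕜] F)‖ * ‖T v‖ := by
      have := (T.symm : G →L[𝕜] F).le_opNorm (T v)
      simpa using this
    have h2 : ‖((T v : G) : X)‖ = ‖T v‖ := rfl
    rw [h2, norm_inv, RCLike.norm_ofReal, abs_of_pos hN0]
    refine h1.trans ?_
    have h3 : ‖(T.symm : G →L[𝕜] F)‖ ≤ K * N⁻¹ := by
      rw [← div_eq_mul_inv, le_div_iff₀ hN0, mul_comm]; exact hT
    calc _ ≤ (K * N⁻¹) * ‖T v‖ := by gcongr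
      _ = _ := by ring
  · refine le_trans ?_ (lp_norm_sum_smul_le hfd hf1 c hB hc)
    rw [hsum, hesum, norm_smul]
    set v : F := ∑ ω, c ω • fF ω
    have h1 : ‖T v‖ ≤ N * ‖v‖ := (T : F →L[𝕜] G).le_opNorm v
    have h2 : ‖((T v : G) : X)‖ = ‖T v‖ := rfl
    have hN0 : 0 ≤ N := norm_nonneg _
    rw [h2, norm_inv, RCLike.norm_ofReal, abs_of_nonneg hN0]
    calc N⁻¹ * ‖T v‖ ≤ N⁻¹ * (N * ‖v‖) := by gcongr
      _ = (N⁻¹ * N) * ‖v‖ := by ring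
      _ ≤ 1 * ‖v‖ := by gcongr; exact inv_mul_le_one
      _ = ‖v‖ := one_mul _

/-- The new vectors are also placed in the kernel of functionals norming `E` up to a factor `2`.
This keeps each `e ω` at distance at least `(3 * K)⁻¹` from `E` plus the span of the other vectors,
and Hahn–Banach supplies `e'`. -/
theorem exists_block {𝕜 X : Type*} [RCLike 𝕜] [NormedAddCommGroup X]
    [NormedSpace 𝕜 X] {p : ℝ≥0∞} [Fact (1 ≤ p)] {K : ℝ} (hK0 : 0 < K)
    (hK : CrudelyFinitelyRepresentableWith 𝕜 (lp (fun _ : ℕ => 𝕜) p) X K)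
    (E : Submodule 𝕜 X) [FiniteDimensional 𝕜 E]
    (Φ : Finset (X →L[𝕜] 𝕜)) (Ω : Type*) [Fintype Ω] [DecidableEq Ω] :
    ∃ (e : Ω → X) (e' : Ω → X →L[𝕜] 𝕜), (∀ φ ∈ Φ, ∀ ω, φ (e ω) = 0) ∧
      (∀ v ∈ E, ∀ ω, e' ω v = 0) ∧ (∀ ω ω', e' ω (e ω') = if ω = ω' then 1 else 0) ∧
      (∀ ω, ‖e' ω‖ ≤ 3 * K) ∧
      ∀ (c : Ω → 𝕜) (B : ℝ), 0 ≤ B → (∀ ω, ‖c ω‖ ≤ B) →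
        ‖∑ ω, c ω • e ω‖ ≤ (Fintype.card Ω : ℝ) ^ (p.toReal⁻¹) * B := by
  classical
  obtain ⟨Ψ, hΨ1, hΨ2⟩ := exists_finset_norming E
  obtain ⟨e, he1, he2, he3⟩ := exists_disjoint_of_functionals hK (Φ ∪ Ψ) Ω
  have key : ∀ ω, ∃ f : X →L[𝕜] 𝕜, f (e ω) = 1 ∧
      (∀ w ∈ E ⊔ Submodule.span 𝕜 (e '' {ω' | ω' ≠ ω}), f w = 0) ∧ ‖f‖ ≤ ((3 * K)⁻¹)⁻¹ := by
    intro ω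
    refine exists_functional_of_le_norm_sub _ _ (by positivity) fun w hw => ?_
    obtain ⟨u, hu, v, hv, rfl⟩ := Submodule.mem_sup.1 hw
    obtain ⟨c, hc0, hc⟩ : ∃ c : Ω → 𝕜, c ω = 1 ∧ ∑ ω', c ω' • e ω' = e ω - v := by
      clear hw
      induction hv using Submodule.span_induction with
      | mem v hv =>
        obtain ⟨ω', hω', rfl⟩ := hv
        refine ⟨Pi.single ω 1 - Pi.single ω' 1, ?_, ?_⟩
        · have : ω ≠ ω' := fun h => hω' h.symm
          simp [this]
        · simp [sub_smul, Finset.sum_sub_distrib, Pi.single_apply, ite_smul]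
      | zero => exact ⟨Pi.single ω 1, by simp, by simp [Pi.single_apply, ite_smul]⟩
      | add v v' _ _ h h' =>
        obtain ⟨c, hc0, hc⟩ := h
        obtain ⟨c', hc0', hc'⟩ := h'
        refine ⟨c + c' - Pi.single ω 1, by simp [hc0, hc0'], ?_⟩
        simp [sub_smul, add_smul, Finset.sum_sub_distrib, Finset.sum_add_distrib, hc, hc',
          Pi.single_apply, ite_smul]
        abel
      | smul r v _ h =>
        obtain ⟨c, hc0, hc⟩ := h
        refine ⟨r • c + (1 - r) • Pi.single ω 1, by simp [hc0], ?_⟩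
        simp [add_smul, Finset.sum_add_distrib, mul_smul, ← Finset.smul_sum, hc,
          Pi.single_apply, ite_smul, smul_sub, sub_smul]
    obtain ⟨ψ, hψ, hψu⟩ := hΨ2 u hu
    have hψ0 : ψ (e ω - v) = 0 := by
      rw [← hc]
      simp [map_sum, he1 ψ (Finset.mem_union_right _ hψ)]
    have h1 : ‖u‖ ≤ 2 * ‖e ω - (u + v)‖ := by
      have e1 : ψ (e ω - (u + v)) = - ψ u := by
        have : e ω - (u + v) = (e ω - v) - u := by abel
        rw [this, map_sub, hψ0, zero_sub]
      have e2 := ψ.le_of_opNorm_le (hΨ1 ψ hψ) (e ω - (u + v))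
      rw [e1, norm_neg, one_mul] at e2
      linarith
    have h2 : ‖e ω - v‖ ≤ 3 * ‖e ω - (u + v)‖ := by
      have : e ω - v = (e ω - (u + v)) + u := by abel
      calc ‖e ω - v‖ = ‖(e ω - (u + v)) + u‖ := by rw [← this]
        _ ≤ _ := norm_add_le _ _
        _ ≤ _ := by linarith
    have h3 := he2 c ω
    rw [hc0, hc, norm_one] at h3
    rw [inv_le_iff_one_le_mul₀ (by positivity)]
    nlinarith
  choose e' h1 h2 h3 using key
  refine ⟨e, e', fun φ hφ ω => he1 φ (Finset.mem_union_left _ hφ) ω, fun v hv ω => ?_,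
    fun ω ω' => ?_, fun ω => by simpa using h3 ω, he3⟩
  · exact h2 ω v (Submodule.mem_sup_left hv)
  · split_ifs with h
    · rw [← h, h1]
    · exact h2 ω _ (Submodule.mem_sup_right (Submodule.subset_span ⟨ω', Ne.symm h, rfl⟩))

/-- Biorthogonal blocks with an upper `ℓ_p`-estimate for flat vectors. -/
structure FlatBlocks (𝕜 X : Type*) [RCLike 𝕜] [NormedAddCommGroup X] [NormedSpace 𝕜 X]
    (Ω : ℕ → Type) [∀ n, Fintype (Ω n)] [∀ n, DecidableEq (Ω n)] (θ C : ℝ) where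
  vec : ∀ n, Ω n → X
  coord : ∀ n, Ω n → X →L[𝕜] 𝕜
  coord_vec : ∀ n ω ω', coord n ω (vec n ω') = if ω = ω' then 1 else 0
  coord_vec_of_ne : ∀ {n m}, n ≠ m → ∀ ω ω', coord n ω (vec m ω') = 0
  norm_coord_le : ∀ n ω, ‖coord n ω‖ ≤ C
  norm_sum_le : ∀ n (c : Ω n → 𝕜) (B : ℝ), 0 ≤ B → (∀ ω, ‖c ω‖ ≤ B) →
    ‖∑ ω, c ω • vec n ω‖ ≤ (Fintype.card (Ω n) : ℝ) ^ θ * B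

/-- The recursion remembers the span of the vectors and the set of functionals used so far: new
vectors are killed by old functionals, and new functionals kill old vectors. -/
theorem exists_flatBlocks {𝕜 X : Type*} [RCLike 𝕜] [NormedAddCommGroup X]
    [NormedSpace 𝕜 X] {p : ℝ≥0∞} [Fact (1 ≤ p)] {K : ℝ} (hK0 : 0 < K)
    (hK : CrudelyFinitelyRepresentableWith 𝕜 (lp (fun _ : ℕ => 𝕜) p) X K)
    (Ω : ℕ → Type) [∀ n, Fintype (Ω n)] [∀ n, DecidableEq (Ω n)] :
    Nonempty (FlatBlocks 𝕜 X Ω p.toReal⁻¹ (3 * K)) := by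
  classical
  let A := {E : Submodule 𝕜 X // FiniteDimensional 𝕜 E} × Finset (X →L[𝕜] 𝕜)
  have step : ∀ (n : ℕ) (s : A), ∃ (e : Ω n → X) (e' : Ω n → X →L[𝕜] 𝕜),
      (∀ φ ∈ s.2, ∀ ω, φ (e ω) = 0) ∧
      (∀ v ∈ s.1.1, ∀ ω, e' ω v = 0) ∧ (∀ ω ω', e' ω (e ω') = if ω = ω' then 1 else 0) ∧
      (∀ ω, ‖e' ω‖ ≤ 3 * K) ∧
      ∀ (c : Ω n → 𝕜) (B : ℝ), 0 ≤ B → (∀ ω, ‖c ω‖ ≤ B) →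
        ‖∑ ω, c ω • e ω‖ ≤ (Fintype.card (Ω n) : ℝ) ^ (p.toReal⁻¹) * B := by
    intro n s
    have := s.1.2
    exact exists_block hK0 hK s.1.1 s.2 (Ω n)
  choose e e' h1 h2 h3 h4 h5 using step
  let nxt : ℕ → A → A := fun n s =>
    ⟨⟨s.1.1 ⊔ Submodule.span 𝕜 (Set.range (e n s)), by
      have := s.1.2
      have := FiniteDimensional.span_of_finite 𝕜 (Set.finite_range (e n s))
      infer_instance⟩, s.2 ∪ Finset.univ.image (e' n s)⟩
  let s : ℕ → A := fun n => Nat.rec ⟨⟨⊥, inferInstance⟩, ∅⟩ nxt n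
  have hs : ∀ n, s (n + 1) = nxt n (s n) := fun n => rfl
  have hE : Monotone fun n => (s n).1.1 := monotone_nat_of_le_succ fun n => by
    rw [hs]; exact le_sup_left
  have hΦ : Monotone fun n => (s n).2 := monotone_nat_of_le_succ fun n => by
    rw [hs]; exact Finset.subset_union_left
  have hEm : ∀ {n m}, n < m → ∀ ω, e n (s n) ω ∈ (s m).1.1 := by
    intro n m h ω
    refine hE (Nat.succ_le_of_lt h) ?_
    change _ ∈ (s (n + 1)).1.1
    rw [hs]
    exact Submodule.mem_sup_right (Submodule.subset_span ⟨ω, rfl⟩)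
  have hΦm : ∀ {n m}, n < m → ∀ ω, e' n (s n) ω ∈ (s m).2 := by
    intro n m h ω
    refine hΦ (Nat.succ_le_of_lt h) ?_
    change _ ∈ (s (n + 1)).2
    rw [hs]
    exact Finset.mem_union_right _ (Finset.mem_image_of_mem _ (Finset.mem_univ _))
  refine ⟨⟨fun n => e n (s n), fun n => e' n (s n), fun n => h3 n (s n), ?_, fun n => h4 n (s n),
    fun n => h5 n (s n)⟩⟩
  intro n m hnm ω ω'
  rcases lt_or_gt_of_ne hnm with h | h
  · exact h1 m (s m) _ (hΦm h ω) ω'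
  · exact h2 n (s n) _ (hEm h ω') ω

/-! ### The spaces attached to points of the Cantor space -/

theorem SignSystem.eta_nonneg {𝕜 : Type*} [RCLike 𝕜] {I Ω : ℕ → Type} [∀ n, Fintype (I n)]
    [∀ n, DecidableEq (I n)] [∀ n, Fintype (Ω n)] [∀ n, Nonempty (Ω n)] (S : SignSystem 𝕜 I Ω)
    (n : ℕ) : 0 ≤ S.η n :=
  (norm_nonneg _).trans (S.avg_b_a n true (Classical.arbitrary _) (Classical.arbitrary _))

section Spaces

variable {𝕜 X : Type*} [RCLike 𝕜] [NormedAddCommGroup X] [NormedSpace 𝕜 X] {I Ω : ℕ → Type}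
  [∀ n, Fintype (I n)] [∀ n, DecidableEq (I n)] [∀ n, Fintype (Ω n)] [∀ n, DecidableEq (Ω n)]
  {θ C : ℝ} (S : SignSystem 𝕜 I Ω) (e : FlatBlocks 𝕜 X Ω θ C)

theorem FlatBlocks.coord_sum (n : ℕ) (ω : Ω n) (c : Ω n → 𝕜) :
    e.coord n ω (∑ ω', c ω' • e.vec n ω') = c ω := by
  simp [map_sum, e.coord_vec]

theorem FlatBlocks.coord_sum_of_ne {n m : ℕ} (h : n ≠ m) (ω : Ω n) (c : Ω m → 𝕜) :
    e.coord n ω (∑ ω', c ω' • e.vec m ω') = 0 := by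
  simp [map_sum, e.coord_vec_of_ne h]

/-- The spanning vectors of the space attached to `x`. -/
def chainVec (x : ℕ → Bool) (n : ℕ) (i : I n) : X :=
  ∑ ω, S.a n i ω • e.vec n ω + ∑ ω, S.b n (x n) i ω • e.vec (n + 1) ω

theorem chainVec_congr {x y : ℕ → Bool} {n : ℕ} (h : x n = y n) (i : I n) :
    chainVec S e x n i = chainVec S e y n i := by
  rw [chainVec, chainVec, h]

theorem coord_chainVec_self (x : ℕ → Bool) (n : ℕ) (i : I n) (ω : Ω n) :
    e.coord n ω (chainVec S e x n i) = S.a n i ω := by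
  rw [chainVec, map_add, e.coord_sum, e.coord_sum_of_ne (by simp), add_zero]

theorem coord_chainVec_succ (x : ℕ → Bool) (n : ℕ) (i : I n) (ω : Ω (n + 1)) :
    e.coord (n + 1) ω (chainVec S e x n i) = S.b n (x n) i ω := by
  rw [chainVec, map_add, e.coord_sum, e.coord_sum_of_ne (by simp), zero_add]

theorem coord_chainVec_of_ne (x : ℕ → Bool) {n k : ℕ} (i : I n) (h : k ≠ n) (h' : k ≠ n + 1)
    (ω : Ω k) : e.coord k ω (chainVec S e x n i) = 0 := by
  rw [chainVec, map_add, e.coord_sum_of_ne h, e.coord_sum_of_ne h', zero_add]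

/-- The coefficient functionals computed in the first component. -/
noncomputable def leftCoord (n : ℕ) (i : I n) : X →L[𝕜] 𝕜 :=
  (Fintype.card (Ω n) : 𝕜)⁻¹ • ∑ ω, S.a n i ω • e.coord n ω

/-- The coefficient functionals computed in the second component. -/
noncomputable def rightCoord (n : ℕ) (t : Bool) (i : I n) : X →L[𝕜] 𝕜 :=
  (Fintype.card (Ω (n + 1)) : 𝕜)⁻¹ • ∑ ω, S.b n t i ω • e.coord (n + 1) ω

theorem leftCoord_apply (n : ℕ) (i : I n) (v : X) :
    leftCoord S e n i v = (Fintype.card (Ω n) : 𝕜)⁻¹ * ∑ ω, S.a n i ω * e.coord n ω v := by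
  simp [leftCoord]

theorem rightCoord_apply (n : ℕ) (t : Bool) (i : I n) (v : X) :
    rightCoord S e n t i v =
      (Fintype.card (Ω (n + 1)) : 𝕜)⁻¹ * ∑ ω, S.b n t i ω * e.coord (n + 1) ω v := by
  simp [rightCoord]

theorem card_inv_mul_cancel (Ω : Type*) [Fintype Ω] [Nonempty Ω] :
    (Fintype.card Ω : 𝕜)⁻¹ * Fintype.card Ω = 1 :=
  inv_mul_cancel₀ (by exact_mod_cast Fintype.card_ne_zero)

/-- The only overlap is that of a tail from level `m` with the heads of level `m + 1`, and these are
orthogonal. -/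
theorem leftCoord_chainVec_of_ne (x : ℕ → Bool) {n m : ℕ} (h : n ≠ m) (i : I n) (j : I m) :
    leftCoord S e n i (chainVec S e x m j) = 0 := by
  rw [leftCoord_apply]
  by_cases h' : n = m + 1
  · subst h'
    simp_rw [coord_chainVec_succ]
    have := S.sum_b_a m (x m) j i
    simp_rw [mul_comm (S.b m (x m) j _)] at this
    rw [this, mul_zero]
  · simp [coord_chainVec_of_ne S e x j h h']

theorem rightCoord_chainVec_of_ne (x : ℕ → Bool) {n m : ℕ} (h : n ≠ m) (i : I n) (j : I m) :
    rightCoord S e n (x n) i (chainVec S e x m j) = 0 := by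
  rw [rightCoord_apply]
  by_cases h' : m = n + 1
  · subst h'
    simp_rw [coord_chainVec_self, S.sum_b_a, mul_zero]
  · have : n + 1 ≠ m := fun h => h' h.symm
    have h2 : n + 1 ≠ m + 1 := fun h3 => h (by omega)
    simp [coord_chainVec_of_ne S e x j this h2]

/-- The space attached to `x`. -/
def chainSpace (x : ℕ → Bool) : Submodule 𝕜 X :=
  (Submodule.span 𝕜 (Set.range fun q : Σ n, I n => chainVec S e x q.1 q.2)).topologicalClosure

theorem chainVec_mem (x : ℕ → Bool) (n : ℕ) (i : I n) : chainVec S e x n i ∈ chainSpace S e x :=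
  Submodule.le_topologicalClosure _ (Submodule.subset_span ⟨⟨n, i⟩, rfl⟩)

theorem chainSpace_le (x : ℕ → Bool) {W : Submodule 𝕜 X} (hW : IsClosed (W : Set X))
    (h : ∀ n i, chainVec S e x n i ∈ W) : chainSpace S e x ≤ W :=
  Submodule.topologicalClosure_minimal _
    (Submodule.span_le.2 (by rintro _ ⟨q, rfl⟩; exact h q.1 q.2)) hW

/-- The averaged trace of a family indexed by the level `n`. -/
noncomputable def levelTrace (n : ℕ) (u : I n → X) : 𝕜 :=
  (Fintype.card (I n) : 𝕜)⁻¹ * ∑ i, leftCoord S e n i (u i)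

theorem levelTrace_eq_left (n : ℕ) (u : I n → X) : levelTrace S e n u =
    (Fintype.card (Ω n) : 𝕜)⁻¹ * ∑ ω, e.coord n ω
      (∑ i, ((Fintype.card (I n) : 𝕜)⁻¹ * S.a n i ω) • u i) := by
  simp only [levelTrace, leftCoord_apply, map_sum, map_smul, smul_eq_mul, Finset.mul_sum]
  rw [Finset.sum_comm]
  exact Finset.sum_congr rfl fun _ _ => Finset.sum_congr rfl fun _ _ => by ring

theorem sum_smul_chainVec (x : ℕ → Bool) (n : ℕ) (c : I n → 𝕜) :
    ∑ i, c i • chainVec S e x n i =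
      ∑ ω, (∑ i, c i * S.a n i ω) • e.vec n ω +
        ∑ ω, (∑ i, c i * S.b n (x n) i ω) • e.vec (n + 1) ω := by
  simp only [chainVec, smul_add, Finset.sum_add_distrib, Finset.smul_sum, Finset.sum_smul,
    smul_smul]
  congr 1 <;> exact Finset.sum_comm

variable [∀ n, Nonempty (Ω n)]

theorem leftCoord_chainVec (x : ℕ → Bool) (n : ℕ) (i j : I n) :
    leftCoord S e n i (chainVec S e x n j) = if i = j then 1 else 0 := by
  rw [leftCoord_apply]
  simp_rw [coord_chainVec_self, S.sum_a_a]
  split_ifs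
  · exact card_inv_mul_cancel _
  · simp

theorem rightCoord_chainVec (x : ℕ → Bool) (n : ℕ) (i j : I n) :
    rightCoord S e n (x n) i (chainVec S e x n j) = if i = j then 1 else 0 := by
  rw [rightCoord_apply]
  simp_rw [coord_chainVec_succ, S.sum_b_b]
  split_ifs
  · exact card_inv_mul_cancel _
  · simp

/-- Both functionals are biorthogonal to the same generators, hence agree on their closed span. This
is what lets a trace move from block `n` to block `n + 1`. -/
theorem leftCoord_eq_rightCoord (x : ℕ → Bool) (n : ℕ) (i : I n) {v : X}
    (hv : v ∈ chainSpace S e x) : leftCoord S e n i v = rightCoord S e n (x n) i v := by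
  have h : chainSpace S e x ≤ LinearMap.ker
      (leftCoord S e n i - rightCoord S e n (x n) i : X →L[𝕜] 𝕜).toLinearMap := by
    refine chainSpace_le S e x (ContinuousLinearMap.isClosed_ker _) fun m j => ?_
    rw [LinearMap.mem_ker]
    change leftCoord S e n i _ - rightCoord S e n (x n) i _ = 0
    by_cases hnm : n = m
    · subst hnm
      rw [leftCoord_chainVec, rightCoord_chainVec, sub_self]
    · rw [leftCoord_chainVec_of_ne S e x hnm, rightCoord_chainVec_of_ne S e x hnm, sub_self]
  exact sub_eq_zero.1 (LinearMap.mem_ker.1 (h hv))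

/-- Averaging over `Ω n` is free of any loss in its size, even though each coordinate is applied to
its own vector. -/
theorem FlatBlocks.norm_avg_coord_le (n : ℕ) (v : Ω n → X) {R : ℝ} (hC : 0 ≤ C)
    (hv : ∀ ω, ‖v ω‖ ≤ R) :
    ‖(Fintype.card (Ω n) : 𝕜)⁻¹ * ∑ ω, e.coord n ω (v ω)‖ ≤ C * R := by
  have hc : (0 : ℝ) < Fintype.card (Ω n) := by exact_mod_cast Fintype.card_pos
  rw [norm_mul, norm_inv, RCLike.norm_natCast, inv_mul_le_iff₀ hc]
  calc ‖∑ ω, e.coord n ω (v ω)‖ ≤ ∑ ω, ‖e.coord n ω (v ω)‖ := _root_.norm_sum_le _ _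
    _ ≤ ∑ _ω : Ω n, C * R := by
        refine Finset.sum_le_sum fun ω _ => ?_
        exact (ContinuousLinearMap.le_of_opNorm_le _ (e.norm_coord_le n ω) _).trans
          (mul_le_mul_of_nonneg_left (hv ω) hC)
    _ = _ := by simp

theorem norm_leftCoord_le (hC : 0 ≤ C) (n : ℕ) (i : I n) : ‖leftCoord S e n i‖ ≤ C := by
  refine ContinuousLinearMap.opNorm_le_bound _ hC fun v => ?_
  rw [leftCoord_apply]
  have : ∀ ω, S.a n i ω * e.coord n ω v = e.coord n ω (S.a n i ω • v) := by simp
  simp_rw [this]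
  exact e.norm_avg_coord_le n _ hC fun ω => by rw [norm_smul, S.norm_a, one_mul]

theorem levelTrace_eq_right (x : ℕ → Bool) (n : ℕ) (u : I n → X)
    (hu : ∀ i, u i ∈ chainSpace S e x) : levelTrace S e n u =
    (Fintype.card (Ω (n + 1)) : 𝕜)⁻¹ * ∑ ω, e.coord (n + 1) ω
      (∑ i, ((Fintype.card (I n) : 𝕜)⁻¹ * S.b n (x n) i ω) • u i) := by
  simp only [levelTrace, leftCoord_eq_rightCoord S e x n _ (hu _), rightCoord_apply, map_sum,
    map_smul, smul_eq_mul, Finset.mul_sum]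
  rw [Finset.sum_comm]
  exact Finset.sum_congr rfl fun _ _ => Finset.sum_congr rfl fun _ _ => by ring

variable [∀ n, Nonempty (I n)]

theorem sum_norm_inv_card_mul {I : Type*} [Fintype I] [Nonempty I] (f : I → 𝕜)
    (hf : ∀ i, ‖f i‖ = 1) : ∑ i, ‖(Fintype.card I : 𝕜)⁻¹ * f i‖ = 1 := by
  have hc : (Fintype.card I : ℝ) ≠ 0 := by exact_mod_cast Fintype.card_ne_zero
  simp [norm_mul, hf, hc]

/-- Passing from level `n` to level `n + 1` changes the averaged trace by little. -/
theorem norm_levelTrace_sub_le (hC : 0 ≤ C) {x x' : ℕ → Bool} {n : ℕ} (hx : x n = x' n)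
    (u : I n → X) (u' : I (n + 1) → X) (hu : ∀ i, u i ∈ chainSpace S e x) {A κ : ℝ} (hA : 0 ≤ A)
    (h : ∀ (c : I n → 𝕜) (c' : I (n + 1) → 𝕜), ‖∑ i, c i • u i + ∑ j, c' j • u' j‖ ≤
      A * ‖∑ i, c i • chainVec S e x' n i + ∑ j, c' j • chainVec S e x' (n + 1) j‖ +
        κ * (∑ i, ‖c i‖ + ∑ j, ‖c' j‖)) :
    ‖levelTrace S e n u - levelTrace S e (n + 1) u'‖ ≤ C * (A * S.error θ n + 2 * κ) := by
  rw [levelTrace_eq_right S e x n u hu, levelTrace_eq_left S e (n + 1) u', ← mul_sub,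
    ← Finset.sum_sub_distrib]
  simp_rw [← map_sub]
  refine e.norm_avg_coord_le (n + 1) _ hC fun ω => ?_
  -- For fixed `ω`, the tail expression at level `n` minus the head expression at level `n + 1` is a
  -- coordinate of one combination, with coefficients of total mass `2`.
  let c : I n → 𝕜 := fun i => (Fintype.card (I n) : 𝕜)⁻¹ * S.b n (x n) i ω
  let c' : I (n + 1) → 𝕜 := fun j => -((Fintype.card (I (n + 1)) : 𝕜)⁻¹ * S.a (n + 1) j ω)
  have e1 : ∑ i, ((Fintype.card (I n) : 𝕜)⁻¹ * S.b n (x n) i ω) • u i -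
      ∑ j, ((Fintype.card (I (n + 1)) : 𝕜)⁻¹ * S.a (n + 1) j ω) • u' j =
      ∑ i, c i • u i + ∑ j, c' j • u' j := by
    simp [c, c', sub_eq_add_neg]
  have s1 : ∑ i, ‖c i‖ = 1 := sum_norm_inv_card_mul _ fun i => S.norm_b _ _ _ _
  have s2 : ∑ j, ‖c' j‖ = 1 := by
    simp_rw [c', norm_neg]
    exact sum_norm_inv_card_mul _ fun i => S.norm_a _ _ _
  rw [e1]
  refine (h c c').trans ?_
  rw [s1, s2]
  have hΦ : ‖∑ i, c i • chainVec S e x' n i + ∑ j, c' j • chainVec S e x' (n + 1) j‖ ≤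
      S.error θ n := by
    rw [sum_smul_chainVec, sum_smul_chainVec]
    -- Three blocks are involved: the tails of level `n` and the heads of level `n + 1` meet on
    -- block `n + 1`, where their correlations nearly cancel.
    have e2 : ∀ p q r s : X, p + q + (r + s) = p + (q + r) + s := fun p q r s => by abel
    rw [e2, ← Finset.sum_add_distrib]
    simp_rw [← add_smul]
    refine (norm_add₃_le).trans ?_
    unfold SignSystem.error
    refine add_le_add (add_le_add ?_ ?_) ?_
    · rw [mul_comm (S.η n)]
      refine e.norm_sum_le n _ _ (S.eta_nonneg n) fun ω' => ?_
      have := S.avg_b_a n (x n) ω ω'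
      simpa [c, Finset.mul_sum, mul_assoc] using this
    · rw [mul_comm (S.η n)]
      refine e.norm_sum_le (n + 1) _ _ (S.eta_nonneg n) fun ω' => ?_
      have := S.avg_sub n (x n) ω ω'
      rw [← hx]
      simpa [c, c', Finset.mul_sum, mul_assoc, sub_eq_add_neg] using this
    · rw [mul_comm (S.η (n + 1))]
      refine e.norm_sum_le (n + 2) _ _ (S.eta_nonneg (n + 1)) fun ω' => ?_
      have := S.avg_b_a (n + 1) (x' (n + 1)) ω' ω
      simp_rw [mul_comm (S.b (n + 1) (x' (n + 1)) _ ω')] at this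
      simpa [c', Finset.mul_sum, mul_assoc] using this
  have := mul_le_mul_of_nonneg_left hΦ hA
  linarith

/-- The averaged trace at a level where the two spaces differ is small. -/
theorem norm_levelTrace_le (hC : 0 ≤ C) {x x' : ℕ → Bool} {n : ℕ} (hx : x n ≠ x' n)
    (u : I n → X) (hu : ∀ i, u i ∈ chainSpace S e x) {A κ : ℝ} (hA : 0 ≤ A)
    (h : ∀ c : I n → 𝕜, ‖∑ i, c i • u i‖ ≤
      A * ‖∑ i, c i • chainVec S e x' n i‖ + κ * ∑ i, ‖c i‖) :
    ‖levelTrace S e n u‖ ≤ C * (A * S.error θ n + κ) := by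
  rw [levelTrace_eq_right S e x n u hu]
  refine e.norm_avg_coord_le (n + 1) _ hC fun ω => ?_
  let c : I n → 𝕜 := fun i => (Fintype.card (I n) : 𝕜)⁻¹ * S.b n (x n) i ω
  have s1 : ∑ i, ‖c i‖ = 1 := sum_norm_inv_card_mul _ fun i => S.norm_b _ _ _ _
  refine (h c).trans ?_
  rw [s1, mul_one]
  have hΦ : ‖∑ i, c i • chainVec S e x' n i‖ ≤ S.error θ n := by
    rw [sum_smul_chainVec]
    refine (norm_add_le _ _).trans ?_
    have h0 : 0 ≤ S.η (n + 1) * (Fintype.card (Ω (n + 2)) : ℝ) ^ θ :=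
      mul_nonneg (S.eta_nonneg _) (by positivity)
    unfold SignSystem.error
    refine le_trans (add_le_add ?_ ?_) (le_add_of_nonneg_right h0)
    · rw [mul_comm (S.η n)]
      refine e.norm_sum_le n _ _ (S.eta_nonneg n) fun ω' => ?_
      have := S.avg_b_a n (x n) ω ω'
      simpa [c, Finset.mul_sum, mul_assoc] using this
    · rw [mul_comm (S.η n)]
      refine e.norm_sum_le (n + 1) _ _ (S.eta_nonneg n) fun ω' => ?_
      have := S.avg_b_b n (x n) (x' n) ω ω' hx
      simpa [c, Finset.mul_sum, mul_assoc] using this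
  have := mul_le_mul_of_nonneg_left hΦ hA
  linarith

/-- If `x` and `x'` first differ at `N`, every family in `chainSpace x` that is dominated by the
spanning vectors of `chainSpace x'` has small averaged trace at the levels up to `N`. -/
theorem norm_levelTrace_le_sum (hC : 0 ≤ C) {x x' : ℕ → Bool} {M N : ℕ} (hMN : M ≤ N)
    (hlt : ∀ n < N, x n = x' n) (hx : x N ≠ x' N) (u : ∀ n, I n → X)
    (hu : ∀ n ≤ N, ∀ i, u n i ∈ chainSpace S e x) {A κ : ℝ} (hA : 0 ≤ A) (hκ : 0 ≤ κ)
    (h : ∀ n ≤ N, ∀ (c : I n → 𝕜) (c' : I (n + 1) → 𝕜),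
      ‖∑ i, c i • u n i + ∑ j, c' j • u (n + 1) j‖ ≤
      A * ‖∑ i, c i • chainVec S e x' n i + ∑ j, c' j • chainVec S e x' (n + 1) j‖ +
        κ * (∑ i, ‖c i‖ + ∑ j, ‖c' j‖)) :
    ‖levelTrace S e M (u M)‖ ≤ ∑ n ∈ Finset.Icc M N, C * (A * S.error θ n + 2 * κ) := by
  induction hMN using Nat.decreasingInduction with
  | self =>
    have h1 := norm_levelTrace_le S e hC hx (u N) (hu N le_rfl) hA (κ := κ) (fun c => by
      simpa using h N le_rfl c 0)
    refine h1.trans ?_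
    simp only [Finset.Icc_self, Finset.sum_singleton]
    gcongr
    linarith
  | of_succ M hM ih =>
    have h1 := norm_levelTrace_sub_le S e hC (hlt M hM) (u M) (u (M + 1)) (hu M hM.le) hA
      (h M hM.le)
    rw [← Finset.insert_Icc_succ_left_eq_Icc hM.le, Finset.sum_insert (by simp)]
    calc ‖levelTrace S e M (u M)‖ = ‖(levelTrace S e M (u M) - levelTrace S e (M + 1) (u (M + 1)))
          + levelTrace S e (M + 1) (u (M + 1))‖ := by rw [sub_add_cancel]
      _ ≤ _ := norm_add_le _ _
      _ ≤ _ := add_le_add h1 ih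

end Spaces

/-! ### Avoiding countably many nowhere dense relations -/

/-- Nowhere density in `2^ℕ × 2^ℕ`, in terms of initial segments. -/
def NowhereDenseRel (R : (ℕ → Bool) → (ℕ → Bool) → Prop) : Prop :=
  ∀ (l : ℕ) (x₀ y₀ : ℕ → Bool), ∃ (l' : ℕ) (x₁ y₁ : ℕ → Bool), l ≤ l' ∧
    (∀ i < l, x₁ i = x₀ i) ∧ (∀ i < l, y₁ i = y₀ i) ∧
    ∀ x y, (∀ i < l', x i = x₁ i) → (∀ i < l', y i = y₁ i) → ¬ R x y

/-- There are finitely many pairs of initial segments of length `l` and indices `k ≤ n`; they are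
treated one after the other, each time lengthening the pair `a`, `b`. -/
theorem NowhereDenseRel.exists_segment {R : ℕ → (ℕ → Bool) → (ℕ → Bool) → Prop}
    (hR : ∀ k, NowhereDenseRel (R k)) (n l : ℕ) :
    ∃ (l' : ℕ) (a b : ℕ → Bool), l < l' ∧ ∀ k ≤ n, ∀ x y,
      (∀ i, l ≤ i → i < l' → x i = a i) → (∀ i, l ≤ i → i < l' → y i = b i) → ¬ R k x y := by
  classical
  have key : ∀ s : Finset ((Fin l → Bool) × (Fin l → Bool) × Fin (n + 1)),
      ∃ (l' : ℕ) (a b : ℕ → Bool), l < l' ∧ ∀ q ∈ s, ∀ x y,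
      (∀ i : Fin l, x i = q.1 i) → (∀ i : Fin l, y i = q.2.1 i) →
      (∀ i, l ≤ i → i < l' → x i = a i) → (∀ i, l ≤ i → i < l' → y i = b i) →
        ¬ R q.2.2 x y := by
    intro s
    induction s using Finset.induction_on with
    | empty => exact ⟨l + 1, fun _ => true, fun _ => true, by simp, by simp⟩
    | insert q s _ ih =>
      obtain ⟨l', a, b, hl, h⟩ := ih
      obtain ⟨l'', a', b', hl', ha', hb', h'⟩ := hR q.2.2 l'
        (fun i => if hi : i < l then q.1 ⟨i, hi⟩ else a i)
        (fun i => if hi : i < l then q.2.1 ⟨i, hi⟩ else b i)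
      refine ⟨l'', a', b', hl.trans_le hl', fun r hr x y hx hy hxa hyb => ?_⟩
      rcases Finset.mem_insert.1 hr with rfl | hr
      · refine h' x y (fun i hi => ?_) (fun i hi => ?_)
        · by_cases hil : i < l
          · rw [ha' i (hil.trans hl), dif_pos hil]
            exact hx ⟨i, hil⟩
          · exact hxa i (not_lt.1 hil) hi
        · by_cases hil : i < l
          · rw [hb' i (hil.trans hl), dif_pos hil]
            exact hy ⟨i, hil⟩
          · exact hyb i (not_lt.1 hil) hi
      · refine h r hr x y hx hy (fun i h1 h2 => ?_) (fun i h1 h2 => ?_)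
        · rw [hxa i h1 (h2.trans_le hl'), ha' i h2, dif_neg (not_lt.2 h1)]
        · rw [hyb i h1 (h2.trans_le hl'), hb' i h2, dif_neg (not_lt.2 h1)]
  obtain ⟨l', a, b, hl, h⟩ := key Finset.univ
  refine ⟨l', a, b, hl, fun k hk x y hx hy => ?_⟩
  exact h (fun i => x i, fun i => y i, ⟨k, Nat.lt_succ_of_le hk⟩) (Finset.mem_univ _) x y
    (fun _ => rfl) (fun _ => rfl) hx hy

/-- Eventual agreement embeds, as a relation, in the complement of a meager relation. -/
theorem exists_measurable_avoiding {R : ℕ → (ℕ → Bool) → (ℕ → Bool) → Prop}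
    (hR : ∀ k, NowhereDenseRel (R k)) :
    ∃ f : (ℕ → Bool) → (ℕ → Bool), Measurable f ∧
      (∀ x y, EventualAgreement x y → EventualAgreement (f x) (f y)) ∧
      ∀ x y, ¬ EventualAgreement x y → ∀ k k', R k (f x) (f y) → ¬ R k' (f y) (f x) := by
  choose L A B hL hAB using NowhereDenseRel.exists_segment hR
  obtain ⟨l, hl0, hl⟩ : ∃ l : ℕ → ℕ, l 0 = 0 ∧ ∀ n, l (n + 1) = L n (l n) :=
    ⟨fun n => Nat.rec 0 (fun n l => L n l) n, rfl, fun _ => rfl⟩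
  have hmono : StrictMono l := strictMono_nat_of_lt_succ fun n => by rw [hl]; exact hL _ _
  have hblock : ∀ i, ∃ n, l n ≤ i ∧ i < l (n + 1) := by
    intro i
    induction i with
    | zero => exact ⟨0, hl0.le, (Nat.zero_le _).trans_lt (hmono (Nat.lt_succ_self 0))⟩
    | succ i ih =>
      obtain ⟨n, h1, h2⟩ := ih
      rcases lt_or_ge (i + 1) (l (n + 1)) with h | h
      · exact ⟨n, by omega, h⟩
      · have h3 := hmono (Nat.lt_succ_self (n + 1))
        exact ⟨n + 1, h, by simp only [Nat.succ_eq_add_one] at h3; omega⟩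
  choose block hb1 hb2 using hblock
  have hbl : ∀ n i, l n ≤ i → i < l (n + 1) → block i = n := by
    intro n i h1 h2
    have h3 : l n < l (block i + 1) := h1.trans_lt (hb2 i)
    have h4 : l (block i) < l (n + 1) := (hb1 i).trans_lt h2
    have h5 := hmono.lt_iff_lt.1 h3
    have h6 := hmono.lt_iff_lt.1 h4
    omega
  -- The digit `x n` decides which of the two avoiding segments fills the `n`-th block.
  let f : (ℕ → Bool) → (ℕ → Bool) := fun x i =>
    bif x (block i) then B (block i) (l (block i)) i else A (block i) (l (block i)) i
  refine ⟨f, ?_, ?_, ?_⟩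
  · refine measurable_pi_lambda _ fun i => ?_
    exact (measurable_of_finite (fun c : Bool =>
      bif c then B (block i) (l (block i)) i else A (block i) (l (block i)) i)).comp
      (measurable_pi_apply (block i))
  · rintro x y ⟨N, hN⟩
    refine ⟨l N, fun i hi => ?_⟩
    have h1 : l N < l (block i + 1) := hi.trans_lt (hb2 i)
    have h2 := hmono.lt_iff_lt.1 h1
    simp only [f, hN (block i) (by omega)]
  · intro x y hxy k k' h1 h2
    have : ∃ n, max k k' ≤ n ∧ x n ≠ y n := by
      by_contra! h
      exact hxy ⟨max k k', h⟩
    obtain ⟨n, hn, hne⟩ := this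
    have hf : ∀ z : ℕ → Bool, z n = false → ∀ i, l n ≤ i → i < L n (l n) →
        f z i = A n (l n) i := by
      intro z hz i hi hi'
      simp only [f, hbl n i hi (hl n ▸ hi'), hz, cond_false]
    have hf' : ∀ z : ℕ → Bool, z n = true → ∀ i, l n ≤ i → i < L n (l n) →
        f z i = B n (l n) i := by
      intro z hz i hi hi'
      simp only [f, hbl n i hi (hl n ▸ hi'), hz, cond_true]
    -- A differing digit excludes `R` in one order of the two points only, depending on which digit
    -- is `true`; hence the conclusion involves both orders.
    cases hx : x n <;> cases hy : y n
    · exact hne (hx.trans hy.symm)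
    · exact hAB n (l n) k (le_trans (le_max_left _ _) hn) _ _ (hf x hx) (hf' y hy) h1
    · exact hAB n (l n) k' (le_trans (le_max_right _ _) hn) _ _ (hf y hy) (hf' x hx) h2
    · exact hne (hx.trans hy.symm)

/-! ### Isomorphisms with almost prescribed values are nowhere dense -/

section Isomorphism

variable {𝕜 X : Type*} [RCLike 𝕜] [NormedAddCommGroup X] [NormedSpace 𝕜 X] {I Ω : ℕ → Type}
  [∀ n, Fintype (I n)] [∀ n, DecidableEq (I n)] [∀ n, Fintype (Ω n)] [∀ n, DecidableEq (Ω n)]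
  {θ C : ℝ} (S : SignSystem 𝕜 I Ω) (e : FlatBlocks 𝕜 X Ω θ C)

theorem exists_mem_span_chainVec_lt (y : ℕ → Bool) {v : X}
    (hv : v ∈ Submodule.span 𝕜 (Set.range fun q : Σ n, I n => chainVec S e y q.1 q.2)) :
    ∃ L : ℕ, v ∈ Submodule.span 𝕜 ((fun q : Σ n, I n => chainVec S e y q.1 q.2) ''
      {q | q.1 < L}) := by
  have mono : ∀ {L L' : ℕ}, L ≤ L' →
      Submodule.span 𝕜 ((fun q : Σ n, I n => chainVec S e y q.1 q.2) '' {q | q.1 < L}) ≤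
      Submodule.span 𝕜 ((fun q : Σ n, I n => chainVec S e y q.1 q.2) '' {q | q.1 < L'}) :=
    fun h => Submodule.span_mono (Set.image_mono fun q hq => lt_of_lt_of_le hq h)
  induction hv using Submodule.span_induction with
  | mem v hv =>
    obtain ⟨q, rfl⟩ := hv
    exact ⟨q.1 + 1, Submodule.subset_span ⟨q, Nat.lt_succ_self _, rfl⟩⟩
  | zero => exact ⟨0, Submodule.zero_mem _⟩
  | add v w _ _ h h' =>
    obtain ⟨L, hL⟩ := h
    obtain ⟨L', hL'⟩ := h'
    exact ⟨max L L', Submodule.add_mem _ (mono (le_max_left _ _) hL) (mono (le_max_right _ _) hL')⟩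
  | smul r v _ h =>
    obtain ⟨L, hL⟩ := h
    exact ⟨L, Submodule.smul_mem _ _ hL⟩

theorem mem_chainSpace_of_mem_span_lt {y y' : ℕ → Bool} {L : ℕ} (h : ∀ n < L, y n = y' n) {v : X}
    (hv : v ∈ Submodule.span 𝕜 ((fun q : Σ n, I n => chainVec S e y' q.1 q.2) ''
      {q | q.1 < L})) : v ∈ chainSpace S e y := by
  refine Submodule.span_le.2 ?_ hv
  rintro _ ⟨q, hq, rfl⟩
  beta_reduce
  rw [← chainVec_congr S e (h q.1 hq)]
  exact chainVec_mem S e y q.1 q.2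

/-- The vectors of `chainSpace` can be approximated by vectors of a space that depends on an
initial segment only. -/
theorem exists_approx_mem_chainSpace (y' : ℕ → Bool) (v : ∀ n, I n → X)
    (hv : ∀ n i, v n i ∈ chainSpace S e y') {κ : ℝ} (hκ : 0 < κ) (N : ℕ) :
    ∃ (w : ∀ n, I n → X) (L : ℕ), (∀ n i, ‖v n i - w n i‖ ≤ κ) ∧
      ∀ y : ℕ → Bool, (∀ k < L, y k = y' k) → ∀ n ≤ N, ∀ i, w n i ∈ chainSpace S e y := by
  have h : ∀ n (i : I n), ∃ (w : X) (L : ℕ), ‖v n i - w‖ ≤ κ ∧ w ∈ Submodule.span 𝕜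
      ((fun q : Σ n, I n => chainVec S e y' q.1 q.2) '' {q | q.1 < L}) := by
    intro n i
    have h1 : v n i ∈ closure ((Submodule.span 𝕜
      (Set.range fun q : Σ n, I n => chainVec S e y' q.1 q.2) : Submodule 𝕜 X) : Set X) := hv n i
    obtain ⟨w, hw, hd⟩ := Metric.mem_closure_iff.1 h1 κ hκ
    obtain ⟨L, hL⟩ := exists_mem_span_chainVec_lt S e y' hw
    exact ⟨w, L, by rw [← dist_eq_norm]; exact hd.le, hL⟩
  choose w L h1 h2 using h
  refine ⟨w, (Finset.range (N + 1)).sup fun n => Finset.univ.sup fun i => L n i, h1,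
    fun y hy n hn i => ?_⟩
  refine mem_chainSpace_of_mem_span_lt S e (fun k hk => hy k (hk.trans_le ?_)) (h2 n i)
  refine le_trans ?_ (Finset.le_sup (f := fun n => Finset.univ.sup fun i => L n i)
    (Finset.mem_range.2 (Nat.lt_succ_of_le hn)))
  exact Finset.le_sup (f := fun i => L n i) (Finset.mem_univ i)

/-- `x` and `y` have `K`-isomorphic spaces, through an operator with almost prescribed values on
the spanning vectors of level `M`. -/
def IsoNear (K : ℝ) (M : ℕ) (d : I M → X) (ε : ℝ) (x y : ℕ → Bool) : Prop :=
  ∃ T : chainSpace S e x ≃L[𝕜] chainSpace S e y,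
    ‖(T : chainSpace S e x →L[𝕜] chainSpace S e y)‖ ≤ K ∧
    ‖(T.symm : chainSpace S e y →L[𝕜] chainSpace S e x)‖ ≤ K ∧
    ∀ i, ‖((T ⟨chainVec S e x M i, chainVec_mem S e x M i⟩ : chainSpace S e y) : X) - d i‖ ≤ ε

variable [∀ n, Nonempty (Ω n)] [∀ n, Nonempty (I n)]

/-- Otherwise, pick a related pair `(x', y')` with operator `T`, then a related pair `(x, y)` with
operator `U`, where `x` and `x'` first differ at `N` and `y` follows `y'` so long that the images
under `T` of the generators up to level `N + 1` are nearly in the space of `y`. Then `U⁻¹ T`, almost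
defined on these generators, carries those of level `M` for `x'` close to those for `x`, as both are
sent near `d`. Its averaged trace is near `1`, against `norm_levelTrace_le_sum`. -/
theorem nowhereDenseRel_isoNear (hC : 0 < C) {K : ℝ} (hK : 0 < K) (M : ℕ) (d : I M → X)
    (hM : ∀ N, C * K ^ 2 * ∑ n ∈ Finset.Icc M N, S.error θ n ≤ 1 / 4) :
    NowhereDenseRel (IsoNear S e K M d (8 * C * K)⁻¹) := by
  set ε : ℝ := (8 * C * K)⁻¹ with hε
  intro l x₀ y₀
  by_contra! hcon
  let N := max l M
  have hlN : l ≤ N := le_max_left _ _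
  have hMN : M ≤ N := le_max_right _ _
  -- At most `N + 1` levels cost `2 * κ` each and the comparison at level `M` costs one more. With
  -- `1 / 4` from the summed errors and `1 / 4` from `ε`, the total is `5 / 8 < 1`.
  let κ : ℝ := (8 * (C * K * (2 * (N + 1) + 1)))⁻¹
  have hκ : 0 < κ := by positivity
  have hκN : C * K * κ * (2 * (N + 1) + 1) = 1 / 8 := by
    simp only [κ]
    have : (2 * ((N : ℝ) + 1) + 1) ≠ 0 := by positivity
    field_simp
  obtain ⟨x', y', hx', hy', T, hT, -, hTd⟩ := hcon (N + 1) (Function.update x₀ N false) y₀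
    (by omega) (fun i hi => by rw [Function.update_of_ne (by omega)]) (fun _ _ => rfl)
  obtain ⟨w, L, hw, hwY⟩ := exists_approx_mem_chainSpace S e y'
    (fun n i => (T ⟨chainVec S e x' n i, chainVec_mem S e x' n i⟩ : X)) (fun n i => Subtype.mem _)
    hκ (N + 1)
  obtain ⟨x, y, hx, hy, U, -, hU, hUd⟩ := hcon (max (N + 1) L) (Function.update x₀ N true) y'
    (by omega) (fun i hi => by rw [Function.update_of_ne (by omega)])
    (fun i hi => hy' i (by omega))
  have hwy : ∀ n ≤ N + 1, ∀ i, w n i ∈ chainSpace S e y :=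
    hwY y fun k hk => hy k (lt_of_lt_of_le hk (le_max_right _ _))
  have hxx : ∀ n < N, x n = x' n := by
    intro n hn
    rw [hx n (by omega), hx' n (by omega), Function.update_of_ne (by omega),
      Function.update_of_ne (by omega)]
  have hne : x N ≠ x' N := by
    rw [hx N (by omega), hx' N (by omega)]
    simp
  -- The value `0` beyond level `N + 1` is never used.
  let W : ∀ n, I n → chainSpace S e y := fun n i =>
    if h : n ≤ N + 1 then ⟨w n i, hwy n h i⟩ else 0
  have hW : ∀ n ≤ N + 1, ∀ i, (W n i : X) = w n i := by
    intro n hn i; simp [W, hn]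
  let u : ∀ n, I n → X := fun n i => (U.symm (W n i) : X)
  have hu : ∀ n ≤ N, ∀ i, u n i ∈ chainSpace S e x := fun n _ i => Subtype.mem _
  have hdom : ∀ n ≤ N, ∀ (c : I n → 𝕜) (c' : I (n + 1) → 𝕜),
      ‖∑ i, c i • u n i + ∑ j, c' j • u (n + 1) j‖ ≤
      K ^ 2 * ‖∑ i, c i • chainVec S e x' n i + ∑ j, c' j • chainVec S e x' (n + 1) j‖ +
        (K * κ) * (∑ i, ‖c i‖ + ∑ j, ‖c' j‖) := by
    intro n hn c c'
    let z : chainSpace S e x' := ∑ i, c i • ⟨chainVec S e x' n i, chainVec_mem S e x' n i⟩ +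
      ∑ j, c' j • ⟨chainVec S e x' (n + 1) j, chainVec_mem S e x' (n + 1) j⟩
    let V : chainSpace S e y := ∑ i, c i • W n i + ∑ j, c' j • W (n + 1) j
    have e1 : ∑ i, c i • u n i + ∑ j, c' j • u (n + 1) j = (U.symm V : X) := by
      simp [V, u]
    have e2 : ∑ i, c i • chainVec S e x' n i + ∑ j, c' j • chainVec S e x' (n + 1) j = (z : X) := by
      simp [z]
    have e3 : (T z : X) - (V : X) =
        ∑ i, c i • ((T ⟨chainVec S e x' n i, chainVec_mem S e x' n i⟩ : X) - w n i) +
        ∑ j, c' j • ((T ⟨chainVec S e x' (n + 1) j, chainVec_mem S e x' (n + 1) j⟩ : X) -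
          w (n + 1) j) := by
      simp only [z, V, map_add, map_sum, map_smul, Submodule.coe_add,
        AddSubmonoidClass.coe_finsetSum, Submodule.coe_smul, hW n (by omega),
        hW (n + 1) (by omega), smul_sub, Finset.sum_sub_distrib]
      abel
    have h3 : ‖(T z : X) - (V : X)‖ ≤ κ * (∑ i, ‖c i‖ + ∑ j, ‖c' j‖) := by
      rw [e3, mul_add, Finset.mul_sum, Finset.mul_sum]
      refine (norm_add_le _ _).trans (add_le_add ?_ ?_)
      · refine (norm_sum_le _ _).trans (Finset.sum_le_sum fun i _ => ?_)
        rw [norm_smul, mul_comm]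
        exact mul_le_mul_of_nonneg_right (hw n i) (norm_nonneg _)
      · refine (norm_sum_le _ _).trans (Finset.sum_le_sum fun i _ => ?_)
        rw [norm_smul, mul_comm]
        exact mul_le_mul_of_nonneg_right (hw (n + 1) i) (norm_nonneg _)
    have h4 : ‖(T z : X)‖ ≤ K * ‖(z : X)‖ :=
      ContinuousLinearMap.le_of_opNorm_le (T : chainSpace S e x' →L[𝕜] chainSpace S e y') hT z
    have h5 : ‖(U.symm V : X)‖ ≤ K * ‖(V : X)‖ :=
      ContinuousLinearMap.le_of_opNorm_le (U.symm : chainSpace S e y →L[𝕜] chainSpace S e x) hU V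
    have h6 : ‖(V : X)‖ ≤ ‖(T z : X)‖ + ‖(T z : X) - (V : X)‖ := by
      have := norm_sub_le (T z : X) ((T z : X) - (V : X))
      simpa using this
    rw [e1, e2]
    calc ‖(U.symm V : X)‖ ≤ K * ‖(V : X)‖ := h5
      _ ≤ K * (K * ‖(z : X)‖ + κ * (∑ i, ‖c i‖ + ∑ j, ‖c' j‖)) := by
          gcongr
          linarith
      _ = _ := by ring
  have hsmall := norm_levelTrace_le_sum S e hC.le hMN hxx hne u hu (sq_nonneg K)
    (mul_pos hK hκ).le hdom
  have hclose : ∀ i, ‖u M i - chainVec S e x M i‖ ≤ K * (2 * ε + κ) := by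
    intro i
    have e1 : u M i - chainVec S e x M i =
        (U.symm (W M i - U ⟨chainVec S e x M i, chainVec_mem S e x M i⟩) : X) := by
      simp [u]
    have h1 := ContinuousLinearMap.le_of_opNorm_le
      (U.symm : chainSpace S e y →L[𝕜] chainSpace S e x) hU
      (W M i - U ⟨chainVec S e x M i, chainVec_mem S e x M i⟩)
    rw [e1]
    refine le_trans h1 (mul_le_mul_of_nonneg_left ?_ hK.le)
    change ‖(W M i : X) - (U ⟨chainVec S e x M i, chainVec_mem S e x M i⟩ : X)‖ ≤ _
    rw [hW M (by omega)]
    have e2 : w M i - (U ⟨chainVec S e x M i, chainVec_mem S e x M i⟩ : X) =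
        -((T ⟨chainVec S e x' M i, chainVec_mem S e x' M i⟩ : X) - w M i) +
        ((T ⟨chainVec S e x' M i, chainVec_mem S e x' M i⟩ : X) - d i) +
        -((U ⟨chainVec S e x M i, chainVec_mem S e x M i⟩ : X) - d i) := by abel
    rw [e2]
    refine norm_add₃_le.trans ?_
    rw [norm_neg, norm_neg]
    linarith [hw M i, hTd i, hUd i]
  have hone : ‖1 - levelTrace S e M (u M)‖ ≤ C * (K * (2 * ε + κ)) := by
    have e1 : 1 - levelTrace S e M (u M) = (Fintype.card (I M) : 𝕜)⁻¹ *
        ∑ i, leftCoord S e M i (chainVec S e x M i - u M i) := by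
      simp only [levelTrace, map_sub, Finset.sum_sub_distrib, mul_sub, leftCoord_chainVec, if_true]
      congr 1
      simp
    have hc : (0 : ℝ) < Fintype.card (I M) := by exact_mod_cast Fintype.card_pos
    rw [e1, norm_mul, norm_inv, RCLike.norm_natCast, inv_mul_le_iff₀ hc]
    calc _ ≤ ∑ i, ‖leftCoord S e M i (chainVec S e x M i - u M i)‖ := norm_sum_le _ _
      _ ≤ ∑ _i : I M, C * (K * (2 * ε + κ)) := by
          refine Finset.sum_le_sum fun i _ => ?_
          refine (ContinuousLinearMap.le_of_opNorm_le _ (norm_leftCoord_le S e hC.le M i) _).trans ?_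
          rw [norm_sub_rev]
          exact mul_le_mul_of_nonneg_left (hclose i) hC.le
      _ = _ := by simp
  have hsum : ∑ n ∈ Finset.Icc M N, C * (K ^ 2 * S.error θ n + 2 * (K * κ)) ≤
      1 / 4 + 2 * (C * K * κ) * (N + 1) := by
    have e1 : ∑ n ∈ Finset.Icc M N, C * (K ^ 2 * S.error θ n + 2 * (K * κ)) =
        C * K ^ 2 * ∑ n ∈ Finset.Icc M N, S.error θ n +
          (Finset.Icc M N).card * (2 * (C * K * κ)) := by
      rw [Finset.mul_sum, ← nsmul_eq_mul, ← Finset.sum_const, ← Finset.sum_add_distrib]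
      exact Finset.sum_congr rfl fun n _ => by ring
    rw [e1]
    have h1 : ((Finset.Icc M N).card : ℝ) ≤ N + 1 := by
      rw [Nat.card_Icc]
      exact_mod_cast Nat.sub_le _ _
    have h2 : 0 ≤ 2 * (C * K * κ) := by positivity
    have := mul_le_mul_of_nonneg_right h1 h2
    linarith [hM N]
  have hCKε : C * K * ε = 1 / 8 := by
    rw [hε]; field_simp
  have hfin : (1 : ℝ) ≤ ‖1 - levelTrace S e M (u M)‖ + ‖levelTrace S e M (u M)‖ := by
    have := norm_add_le (1 - levelTrace S e M (u M)) (levelTrace S e M (u M))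
    rwa [sub_add_cancel, norm_one] at this
  have hge : 0 ≤ C * K * κ := by positivity
  nlinarith

end Isomorphism

/-! ### Eventual agreement gives isomorphism; the Borel reduction -/

section Reduction

variable {𝕜 X : Type*} [RCLike 𝕜] [NormedAddCommGroup X] [NormedSpace 𝕜 X] {I Ω : ℕ → Type}
  [∀ n, Fintype (I n)] [∀ n, DecidableEq (I n)] [∀ n, Fintype (Ω n)] [∀ n, DecidableEq (Ω n)]
  {θ C : ℝ} (S : SignSystem 𝕜 I Ω) (e : FlatBlocks 𝕜 X Ω θ C)

/-- The operator replacing the spanning vectors of level below `N` for `x` by those for `y`. -/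
noncomputable def exchange (x y : ℕ → Bool) (N : ℕ) : X →L[𝕜] X :=
  ContinuousLinearMap.id 𝕜 X + ∑ n ∈ Finset.range N, ∑ i,
    (leftCoord S e n i).smulRight (chainVec S e y n i - chainVec S e x n i)

theorem continuous_chainVec (n : ℕ) (i : I n) : Continuous fun x => chainVec S e x n i :=
  (continuous_of_discreteTopology (f := fun t : Bool =>
    ∑ ω, S.a n i ω • e.vec n ω + ∑ ω, S.b n t i ω • e.vec (n + 1) ω)).comp (continuous_apply n)

/-- An open set meets the closure of a span when it meets the span, and each fixed finite
combination of generators depends continuously on `x`. -/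
theorem isOpen_setOf_chainSpace_inter_nonempty {U : Set X} (hU : IsOpen U) :
    IsOpen {x | ((chainSpace S e x : Set X) ∩ U).Nonempty} := by
  have h : {x | ((chainSpace S e x : Set X) ∩ U).Nonempty} =
      ⋃ c : (Σ n, I n) →₀ 𝕜, {x | c.sum (fun q r => r • chainVec S e x q.1 q.2) ∈ U} := by
    ext x
    simp only [Set.mem_ofPred_eq, Set.mem_iUnion]
    rw [chainSpace, Submodule.topologicalClosure_coe, closure_inter_open_nonempty_iff hU]
    constructor
    · rintro ⟨v, hv, hvU⟩
      obtain ⟨c, rfl⟩ := Finsupp.mem_span_range_iff_exists_finsupp.1 hv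
      exact ⟨c, hvU⟩
    · rintro ⟨c, hc⟩
      exact ⟨_, Finsupp.mem_span_range_iff_exists_finsupp.2 ⟨c, rfl⟩, hc⟩
  rw [h]
  refine isOpen_iUnion fun c => hU.preimage ?_
  exact continuous_finsetSum _ fun q _ => (continuous_chainVec S e q.1 q.2).const_smul _

variable [∀ n, Nonempty (Ω n)]

/-- By biorthogonality only the terms of level `m` act, and from level `N` on the two families of
generators coincide. -/
theorem exchange_chainVec {x y : ℕ → Bool} {N : ℕ} (h : ∀ n, N ≤ n → x n = y n) (m : ℕ)
    (j : I m) : exchange S e x y N (chainVec S e x m j) = chainVec S e y m j := by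
  have hs : ∀ n, n ≠ m → ∑ i, leftCoord S e n i (chainVec S e x m j) •
      (chainVec S e y n i - chainVec S e x n i) = 0 := by
    intro n hn
    simp [leftCoord_chainVec_of_ne S e x hn]
  have e1 : exchange S e x y N (chainVec S e x m j) = chainVec S e x m j +
      ∑ n ∈ Finset.range N, ∑ i, leftCoord S e n i (chainVec S e x m j) •
        (chainVec S e y n i - chainVec S e x n i) := by
    simp [exchange]
  rw [e1]
  by_cases hm : m < N
  · rw [Finset.sum_eq_single_of_mem m (Finset.mem_range.2 hm) fun n _ hn => hs n hn]
    simp [leftCoord_chainVec]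
  · rw [Finset.sum_eq_zero fun n hn => hs n (by have := Finset.mem_range.1 hn; omega), add_zero]
    exact chainVec_congr S e (h m (not_lt.1 hm)) j

theorem exchange_mem {x y : ℕ → Bool} {N : ℕ} (h : ∀ n, N ≤ n → x n = y n) {v : X}
    (hv : v ∈ chainSpace S e x) : exchange S e x y N v ∈ chainSpace S e y := by
  have : chainSpace S e x ≤ (chainSpace S e y).comap (exchange S e x y N).toLinearMap := by
    refine chainSpace_le S e x ?_ fun n i => ?_
    · exact (Submodule.isClosed_topologicalClosure _).preimage (exchange S e x y N).continuous
    · rw [Submodule.mem_comap]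
      change exchange S e x y N _ ∈ _
      rw [exchange_chainVec S e h]
      exact chainVec_mem S e y n i
  exact this hv

theorem exchange_exchange {x y : ℕ → Bool} {N : ℕ} (h : ∀ n, N ≤ n → x n = y n) {v : X}
    (hv : v ∈ chainSpace S e x) : exchange S e y x N (exchange S e x y N v) = v := by
  have : chainSpace S e x ≤ LinearMap.ker
      ((exchange S e y x N).comp (exchange S e x y N) - ContinuousLinearMap.id 𝕜 X).toLinearMap := by
    refine chainSpace_le S e x (ContinuousLinearMap.isClosed_ker _) fun n i => ?_
    rw [LinearMap.mem_ker]
    change exchange S e y x N (exchange S e x y N _) - _ = 0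
    rw [exchange_chainVec S e h, exchange_chainVec S e fun n hn => (h n hn).symm]
    simp
  exact sub_eq_zero.1 (LinearMap.mem_ker.1 (this hv))

theorem chainSpace_equiv_of_eventualAgreement {x y : ℕ → Bool} (h : EventualAgreement x y) :
    Nonempty (chainSpace S e x ≃L[𝕜] chainSpace S e y) := by
  obtain ⟨N, hN⟩ := h
  have hN' : ∀ n, N ≤ n → y n = x n := fun n hn => (hN n hn).symm
  refine ⟨ContinuousLinearEquiv.equivOfInverse
    (((exchange S e x y N).comp (chainSpace S e x).subtypeL).codRestrict (chainSpace S e y)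
      fun v => exchange_mem S e hN v.2)
    (((exchange S e y x N).comp (chainSpace S e y).subtypeL).codRestrict (chainSpace S e x)
      fun v => exchange_mem S e hN' v.2)
    (fun v => Subtype.ext (exchange_exchange S e hN v.2))
    (fun v => Subtype.ext (exchange_exchange S e hN' v.2))⟩

theorem not_finiteDimensional_chainSpace [∀ n, Nonempty (I n)] (x : ℕ → Bool) :
    ¬ FiniteDimensional 𝕜 (chainSpace S e x) := by
  intro hfin
  let i₀ : ∀ n, I n := fun n => Classical.arbitrary _
  have hli : LinearIndependent 𝕜 fun n : ℕ =>
      (⟨chainVec S e x n (i₀ n), chainVec_mem S e x n (i₀ n)⟩ : chainSpace S e x) := by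
    refine LinearIndependent.of_pairwise_dual_eq_zero_one _
      (fun n => (leftCoord S e n (i₀ n)).toLinearMap ∘ₗ (chainSpace S e x).subtype) ?_ ?_
    · intro n m hnm
      exact leftCoord_chainVec_of_ne S e x hnm _ _
    · intro n
      exact (leftCoord_chainVec S e x n _ _).trans (if_pos rfl)
  have := hli.finite_of_isNoetherian
  exact not_finite ℕ

/-- The space attached to `x`, as an infinite-dimensional closed subspace. -/
def chainSB [∀ n, Nonempty (I n)] (x : ℕ → Bool) : SB 𝕜 X :=
  ⟨⟨chainSpace S e x, Submodule.isClosed_topologicalClosure _⟩,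
    not_finiteDimensional_chainSpace S e x⟩

theorem measurable_chainSB [∀ n, Nonempty (I n)] : Measurable (chainSB S e) := by
  refine measurable_comap_iff.2 (measurable_generateFrom ?_)
  rintro _ ⟨U, hU, rfl⟩
  exact (isOpen_setOf_chainSpace_inter_nonempty S e hU).measurableSet

theorem exists_forall_sum_Icc_le {f : ℕ → ℝ} (hf : Summable f) {ε : ℝ} (hε : 0 < ε) :
    ∃ M, ∀ N, ∑ n ∈ Finset.Icc M N, f n ≤ ε := by
  obtain ⟨s, hs⟩ := summable_iff_vanishing_norm.1 hf ε hε
  refine ⟨s.sup id + 1, fun N => ?_⟩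
  refine (le_abs_self _).trans (hs _ ?_).le
  refine Finset.disjoint_left.2 fun n hn hns => ?_
  have h1 := (Finset.mem_Icc.1 hn).1
  have h2 : n ≤ s.sup id := Finset.le_sup (f := id) hns
  omega

theorem borelReducible_of_signSystem (e : FlatBlocks 𝕜 X Ω θ C)
    [∀ n, Nonempty (I n)] [TopologicalSpace.SeparableSpace X] (hC : 0 < C)
    (hS : Summable (S.error θ)) :
    BorelReducible EventualAgreement (SB.Isomorphic (𝕜 := 𝕜) (X := X)) := by
  have hM : ∀ K : ℕ, ∃ M, ∀ N, C * ((K : ℝ) + 1) ^ 2 * ∑ n ∈ Finset.Icc M N, S.error θ n ≤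
      1 / 4 := by
    intro K
    have hpos : 0 < C * ((K : ℝ) + 1) ^ 2 := by positivity
    obtain ⟨M, hM⟩ := exists_forall_sum_Icc_le hS (ε := (4 * (C * ((K : ℝ) + 1) ^ 2))⁻¹)
      (by positivity)
    refine ⟨M, fun N => (mul_le_mul_of_nonneg_left (hM N) hpos.le).trans_eq ?_⟩
    field_simp
  choose M hM using hM
  -- Countable because `I (M K)` is finite: a bound on the norms together with targets in a dense
  -- sequence.
  let ι := Σ K : ℕ, I (M K) → ℕ
  have : Nonempty ι := ⟨⟨0, fun _ => 0⟩⟩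
  obtain ⟨g, hg⟩ := exists_surjective_nat ι
  let Q : ι → (ℕ → Bool) → (ℕ → Bool) → Prop := fun k =>
    IsoNear S e ((k.1 : ℝ) + 1) (M k.1) (fun i => TopologicalSpace.denseSeq X (k.2 i))
      (8 * C * ((k.1 : ℝ) + 1))⁻¹
  have hQ : ∀ k, NowhereDenseRel (Q k) := fun k =>
    nowhereDenseRel_isoNear S e hC (by positivity) _ _ (hM k.1)
  obtain ⟨f, hf, hfE, hfN⟩ := exists_measurable_avoiding (R := fun n => Q (g n)) fun n => hQ _
  have hiso : ∀ x y, Nonempty (chainSpace S e x ≃L[𝕜] chainSpace S e y) → ∃ n, Q (g n) x y := by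
    rintro x y ⟨T⟩
    obtain ⟨K, hK⟩ := exists_nat_ge
      (max ‖(T : chainSpace S e x →L[𝕜] chainSpace S e y)‖
        ‖(T.symm : chainSpace S e y →L[𝕜] chainSpace S e x)‖)
    have hε : 0 < (8 * C * ((K : ℝ) + 1))⁻¹ := by positivity
    have hd : ∀ i : I (M K), ∃ m, ‖((T ⟨chainVec S e x (M K) i, chainVec_mem S e x (M K) i⟩ :
        chainSpace S e y) : X) - TopologicalSpace.denseSeq X m‖ ≤ (8 * C * ((K : ℝ) + 1))⁻¹ := by
      intro i
      obtain ⟨m, hm⟩ := (TopologicalSpace.denseRange_denseSeq X).exists_dist_lt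
        ((T ⟨chainVec S e x (M K) i, chainVec_mem S e x (M K) i⟩ : chainSpace S e y) : X) hε
      exact ⟨m, by rw [← dist_eq_norm]; exact hm.le⟩
    choose d hd using hd
    obtain ⟨n, hn⟩ := hg ⟨K, d⟩
    refine ⟨n, ?_⟩
    rw [hn]
    exact ⟨T, by linarith [le_max_left _ _ |>.trans hK], by linarith [le_max_right _ _ |>.trans hK],
      hd⟩
  refine ⟨fun x => chainSB S e (f x), (measurable_chainSB S e).comp hf, fun x y => ⟨fun h => ?_,
    fun h => ?_⟩⟩
  · exact chainSpace_equiv_of_eventualAgreement S e (hfE x y h)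
  · by_contra hxy
    obtain ⟨T⟩ : Nonempty (chainSpace S e (f x) ≃L[𝕜] chainSpace S e (f y)) := h
    obtain ⟨k, hk⟩ := hiso _ _ ⟨T⟩
    obtain ⟨k', hk'⟩ := hiso _ _ ⟨T.symm⟩
    exact hfN x y hxy k k' hk hk'

end Reduction

/-! ### The ergodicity theorem and the case of `ℓ_p` -/

theorem inv_toReal_lt_half {p : ℝ≥0∞} (hp : 2 < p) : p.toReal⁻¹ < 1 / 2 := by
  rcases eq_or_ne p ∞ with rfl | h
  · simp
  · have h2 : 2 < p.toReal := by
      have := (ENNReal.toReal_lt_toReal (by simp) h).2 hp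
      simpa using this
    rw [one_div]
    exact inv_strictAnti₀ two_pos h2

theorem isErgodicSpace_of_crudelyFinitelyRepresentable {𝕜 X : Type*} [RCLike 𝕜]
    [NormedAddCommGroup X] [NormedSpace 𝕜 X] [CompleteSpace X]
    [hsep : TopologicalSpace.SeparableSpace X] {p : ℝ≥0∞} [Fact (1 ≤ p)] (hp : 2 < p)
    (h : CrudelyFinitelyRepresentable 𝕜 (lp (fun _ : ℕ => 𝕜) p) X) : IsErgodicSpace 𝕜 X := by
  obtain ⟨K, hK0, hK⟩ := h
  obtain ⟨S, hS⟩ := exists_signSystem 𝕜 p.toReal⁻¹ (inv_toReal_lt_half hp)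
  obtain ⟨e⟩ := exists_flatBlocks hK0 hK (fun n => (Fin n → Bool) × Bool × Bool)
  exact ⟨hsep, borelReducible_of_signSystem S e (by positivity) hS⟩

theorem crudelyFinitelyRepresentable_self (𝕜 X : Type*) [RCLike 𝕜] [NormedAddCommGroup X]
    [NormedSpace 𝕜 X] : CrudelyFinitelyRepresentable 𝕜 X X := by
  refine ⟨1, one_pos, fun F _ => ⟨F, ContinuousLinearEquiv.refl 𝕜 F, ?_⟩⟩
  exact mul_le_one₀ ContinuousLinearMap.norm_id_le (norm_nonneg _) ContinuousLinearMap.norm_id_le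

theorem separableSpace_lp (𝕜 : Type*) [RCLike 𝕜] {p : ℝ≥0∞} [Fact (1 ≤ p)] (hp : p ≠ ∞) :
    TopologicalSpace.SeparableSpace (lp (fun _ : ℕ => 𝕜) p) := by
  have h1 : TopologicalSpace.IsSeparable
      (Set.range fun i : ℕ => (lp.single p i (1 : 𝕜) : lp (fun _ : ℕ => 𝕜) p)) :=
    (Set.countable_range _).isSeparable
  have h2 := (h1.span (R := 𝕜)).closure
  refine TopologicalSpace.isSeparable_univ_iff.1 (h2.mono fun f _ => ?_)
  refine mem_closure_of_tendsto (lp.hasSum_single hp f) (Filter.Eventually.of_forall fun s => ?_)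
  refine Submodule.sum_mem _ fun i _ => ?_
  have : lp.single p i (f i) = f i • (lp.single p i (1 : 𝕜) : lp (fun _ : ℕ => 𝕜) p) := by
    rw [← lp.single_smul, smul_eq_mul, mul_one]
  rw [this]
  exact Submodule.smul_mem _ _ (Submodule.subset_span ⟨i, rfl⟩)

theorem mainTheorem7 {𝕜 : Type*} [RCLike 𝕜] (p : ℝ≥0∞) [Fact (1 ≤ p)] (hp : 2 < p) :
    (∀ (X : Type*) [NormedAddCommGroup X] [NormedSpace 𝕜 X] [CompleteSpace X]
        [TopologicalSpace.SeparableSpace X],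
        CrudelyFinitelyRepresentable 𝕜 (lp (fun _ : ℕ => 𝕜) p) X → IsErgodicSpace 𝕜 X) ∧
      (p ≠ ∞ → IsErgodicSpace 𝕜 (lp (fun _ : ℕ => 𝕜) p)) := by
  refine ⟨fun X _ _ _ _ h => isErgodicSpace_of_crudelyFinitelyRepresentable hp h, fun hpt => ?_⟩
  have := separableSpace_lp 𝕜 hpt
  exact isErgodicSpace_of_crudelyFinitelyRepresentable hp (crudelyFinitelyRepresentable_self 𝕜 _)
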